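/- Let $V$ be a set and let $G=(V,E,m,\mu)$ be a locally finite weighted graph (self-loops allowed, connectedness not required): $m:V\to(0,\infty)$ is a measure on the vertices, and $\mu_{xy}=\mu_{yx}\ge 0$ are edge weights, with $\mu_{xy}=0$ if $x,y$ are not adjacent. For $f,g:V\to\mathbb R$ put $$\Delta f(x)=\frac1{m(x)}\sum_{y\in V}\mu_{xy}\,(f(y)-f(x)),\qquad \Gamma(f,g)=\tfrac12\big(\Delta(fg)-f\Delta g-g\Delta f\big),\qquad \Gamma(f)=\Gamma(f,f),$$ $$\Gamma_2(f)=\tfrac12\Delta\Gamma(f)-\Gamma(f,\Delta f).$$ Let $\ell^2(V,m)$ be the space of $f:V\to\mathbb R$ with $\sum_x m(x)f(x)^2<\infty$, let $Q(f)=\frac12\sum_{x,y}\mu_{xy}(f(y)-f(x))^2$, and let $D(Q)\subset\ell^2(V,m)$ be the closure of the finitely supported functions with respect to the norm $(\|f\|_{\ell^2(V,m)}^2+Q(f))^{1/2}$. Let $P_t=e^{t\Delta}$, $t\ge0$, be the heat semigroup on $\ell^2(V,m)$, that is, the semigroup generated by the self-adjoint operator associated with the closed form $(Q,D(Q))$ (this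 generator acts as $\Delta$). Assume that $m$ is nondegenerate, i.e. $\inf_{x\in V}m(x)>0$, and that $G$ is complete, i.e. there is a nondecreasing sequence $(\eta_k)_{k\ge1}$ of finitely supported functions on $V$ with $\lim_{k\to\infty}\eta_k=1$ pointwise and $\Gamma(\eta_k)\le\frac1k$ on $V$ for all $k$. Let $K\in\mathbb R$ and $n\in(0,\infty)$. Then the following are equivalent: (a) $G$ satisfies $CD(K,n)$: for all $f:V\to\mathbb R$, $\ \Gamma_2(f)\ge\frac1n(\Delta f)^2+K\,\Gamma(f)$ on $V$. (b) For every finitely supported $f:V\to\mathbb R$, every $t\ge0$ and every vertex, the integral below converges and $$\Gamma(P_tf)\le e^{-2Kt}P_t\Gamma(f)-\frac2n\int_0^t e^{-2Ks}\,P_s\big((\Delta P_{t-s}f)^2\big)\,ds .$$ (c) The assertion of (b) (convergence of the integral and the inequality, for every $t\ge0$ and every vertex) holds for every $f\in D(Q)$. -/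

import Mathlib

open Filter Topology MeasureTheory
open scoped ENNReal

/-- A locally finite weighted graph on the vertex set `V` (self-loops are allowed): a symmetric
adjacency relation with finite neighbourhoods, symmetric nonnegative edge weights `μ`, extended by
zero to non-adjacent pairs, and a measure `m` on the vertices. -/
structure WeightedGraph (V : Type*) where
  Adj : V → V → Prop
  adj_symm : ∀ x y, Adj x y → Adj y x
  locallyFinite : ∀ x, {y | Adj x y}.Finite
  μ : V → V → ℝ
  μ_nonneg : ∀ x y, 0 ≤ μ x y
  μ_symm : ∀ x y, μ x y = μ y x
  μ_eq_zero : ∀ x y, ¬ Adj x y → μ x y = 0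
  m : V → ℝ
  m_pos : ∀ x, 0 < m x

namespace WeightedGraph

variable {V : Type*} (G : WeightedGraph V)

/-- The Laplacian `Δ f (x) = (1 / m x) ∑_{y ∼ x} μ_{xy} (f y - f x)`. -/
noncomputable def lap (f : V → ℝ) (x : V) : ℝ :=
  (G.m x)⁻¹ * ∑ y ∈ (G.locallyFinite x).toFinset, G.μ x y * (f y - f x)

/-- `Γ(f, g) = (Δ(fg) - f Δg - g Δf) / 2`. -/
noncomputable def Gam (f g : V → ℝ) (x : V) : ℝ :=
  (1 / 2) * (G.lap (fun y => f y * g y) x - f x * G.lap g x - g x * G.lap f x)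

/-- `Γ₂(f, g) = (Δ Γ(f, g) - Γ(f, Δg) - Γ(g, Δf)) / 2`. -/
noncomputable def Gam2 (f g : V → ℝ) (x : V) : ℝ :=
  (1 / 2) * (G.lap (G.Gam f g) x - G.Gam f (G.lap g) x - G.Gam g (G.lap f) x)

/-- The curvature dimension condition `CD(K, n)`: `Γ₂(f) ≥ (Δf)² / n + K Γ(f)` pointwise. -/
def CD (K n : ℝ) : Prop :=
  ∀ (f : V → ℝ) (x : V), (1 / n) * (G.lap f x) ^ 2 + K * G.Gam f f x ≤ G.Gam2 f f x

/-- The vertex measure is bounded away from zero. -/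
def Nondegenerate : Prop := ∃ δ : ℝ, 0 < δ ∧ ∀ x, δ ≤ G.m x

/-- The graph is complete: there is a nondecreasing sequence of finitely supported functions
that converges pointwise to `1`, the `k`-th function (`k = 1, 2, …`) having `Γ ≤ 1 / k`. -/
def Complete : Prop :=
  ∃ η : ℕ → V → ℝ, Monotone η ∧ (∀ k, (Function.support (η k)).Finite) ∧
    (∀ x, Tendsto (fun k => η k x) atTop (𝓝 1)) ∧
    ∀ k x, G.Gam (η k) (η k) x ≤ 1 / ((k : ℝ) + 1)

/-- `‖u‖² = ∑ m(x) u(x)²` in `ℓ²(V, m)`, as an extended nonnegative number. -/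
noncomputable def normSq (u : V → ℝ) : ℝ≥0∞ := ∑' x, ENNReal.ofReal (G.m x * u x ^ 2)

/-- The energy `Q(u) = (1/2) ∑_{x,y} μ_{xy} (u y - u x)²`, as an extended nonnegative number. -/
noncomputable def energy (u : V → ℝ) : ℝ≥0∞ :=
  (1 / 2) * ∑' p : V × V, ENNReal.ofReal (G.μ p.1 p.2 * (u p.2 - u p.1) ^ 2)

/-- The space `ℓ²(V, m)`. -/
def ell2 : Set (V → ℝ) := {u | G.normSq u < ∞}

/-- The inner product of `ℓ²(V, m)`. -/
noncomputable def inner2 (u v : V → ℝ) : ℝ := ∑' x, G.m x * u x * v x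

/-- The domain `D(Q)` of the Dirichlet form: the closure of the finitely supported functions in
`ℓ²(V, m)` for the form norm `(‖u‖² + Q(u))^{1/2}`. -/
def domQ : Set (V → ℝ) :=
  {u | u ∈ G.ell2 ∧ ∀ ε : ℝ≥0∞, 0 < ε → ∃ φ : V → ℝ, (Function.support φ).Finite ∧
    G.normSq (u - φ) + G.energy (u - φ) < ε}

/-- The Dirichlet form `Q(u, v) = (1/2) ∑_{x,y} μ_{xy} (u y - u x) (v y - v x)`; the sum converges
absolutely for `u, v ∈ D(Q)`. -/
noncomputable def form (u v : V → ℝ) : ℝ :=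
  (1 / 2) * ∑' p : V × V, G.μ p.1 p.2 * (u p.2 - u p.1) * (v p.2 - v p.1)

/-- The graph of the generator of `Q`: `u ∈ D(Q)` lies in the domain of the generator with image
`w ∈ ℓ²(V, m)` if and only if `⟨w, h⟩ = - Q(u, h)` for all `h ∈ D(Q)`. -/
def IsGenerator (u w : V → ℝ) : Prop :=
  u ∈ G.domQ ∧ w ∈ G.ell2 ∧ ∀ h ∈ G.domQ, G.inner2 w h = - G.form u h

open Classical in
/-- The resolvent `(α - Δ)⁻¹ g` of the generator: for `α > 0` and `g ∈ ℓ²(V, m)`, the unique `u`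
in the domain of the generator with `Δ u = α u - g`. -/
noncomputable def resolvent (α : ℝ) (g : V → ℝ) : V → ℝ :=
  if h : ∃ u, G.IsGenerator u (α • u - g) then h.choose else 0

/-- `exp (t A_α) g` for the Yosida approximation `A_α = α (α (α - Δ)⁻¹ - 1)` of the generator,
written as `e^{-tα} ∑_k (tα)^k / k! (α (α - Δ)⁻¹)^k g`. -/
noncomputable def yosidaExp (α t : ℝ) (g : V → ℝ) (x : V) : ℝ :=
  Real.exp (-(t * α)) *
    ∑' k : ℕ, (t * α) ^ k / (k.factorial : ℝ) * ((fun u => α • G.resolvent α u)^[k] g) x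

/-- The heat semigroup `P_t = e^{tΔ}` on `ℓ²(V, m)`, that is, the semigroup of the generator of
`Q`, constructed by the Hille–Yosida theorem as the limit of `exp (t A_α)` for `α → ∞`. (The limit
exists in `ℓ²(V, m)`, hence at each vertex, for every `g ∈ ℓ²(V, m)` and `t ≥ 0`.) -/
noncomputable def heat (t : ℝ) (g : V → ℝ) (x : V) : ℝ :=
  limUnder atTop (fun α : ℝ => G.yosidaExp α t g x)

/-- The integrand `s ↦ e^{-2Ks} P_s ((Δ P_{t-s} f)²) (x)`. -/
noncomputable def integrand (K t : ℝ) (f : V → ℝ) (x : V) (s : ℝ) : ℝ :=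
  Real.exp (-2 * K * s) * G.heat s (fun y => (G.lap (G.heat (t - s) f) y) ^ 2) x

/-- The dimensional gradient estimate for the function `f`, at all times and vertices:
`Γ(P_t f) ≤ e^{-2Kt} P_t Γ(f) - (2/n) ∫₀ᵗ e^{-2Ks} P_s (Δ P_{t-s} f)² ds`, with a convergent
integral. -/
def GradientEstimate (K n : ℝ) (f : V → ℝ) : Prop :=
  ∀ (t : ℝ), 0 ≤ t → ∀ x : V,
    IntervalIntegrable (G.integrand K t f x) volume 0 t ∧
    G.Gam (G.heat t f) (G.heat t f) x ≤
      Real.exp (-2 * K * t) * G.heat t (G.Gam f f) x -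
        (2 / n) * ∫ s in (0 : ℝ)..t, G.integrand K t f x s

end WeightedGraph

/-! For (a) ⇒ (c), fix a vertex `x` and a time `t`, and interpolate with F(s) = e^{-2Ks} P_s
Γ(P_{t-s} f)(x), which runs from Γ(P_t f)(x) to e^{-2Kt} P_t Γ(f)(x). Formally, with u = P_{t-s} f,
F'(s) = e^{-2Ks} P_s(ΔΓ(u) - 2Γ(u, Δu) - 2KΓ(u))(x), and CD(K,n) bounds this below by (2/n) e^{-2Ks}
P_s((Δu)²)(x). Integrating over [0, t] gives the estimate.

The difficulty is that Γ(u) need not lie in the domain of the generator. Since P_s is symmetric,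
F(s) = e^{-2Ks}⟨ψ_s, Γ(u)⟩, where ψ_s is the heat flow of the point evaluation at `x`, so that Δ can
fall on ψ_s instead. Moving it back to Γ(u) needs only that Γ(u) has finite energy. Nondegeneracy
gives ℓ¹ ⊂ ℓ², so Γ(u) and all terms of the curvature bound are in ℓ². CD thus bounds ΔΓ(u) below by
an ℓ² function, and a Caccioppoli argument with the cutoffs of completeness gives finite energy
(`Complete.exists_isGrad_of_le_lap`). The resulting weak Bochner inequality is `Complete.bochner`;
`Complete.gradientEstimate` carries out the integration.

The analysis takes place in ℓ²: functions are described by coordinates, and gradients are elements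
of an ℓ² space over ordered pairs. Completeness identifies D(Q) with all ℓ² functions of finite
energy. The heat semigroup comes from Yosida approximations; a Lyapunov function supplies the
smoothing bound ‖ΔP_t‖ ≤ 1/t, which makes F differentiable inside the interval. Convergence of the
heat flow in energy makes F continuous up to its ends.

(c) ⇒ (b) holds because finitely supported functions lie in D(Q). For (b) ⇒ (a), both sides agree at
t = 0, and comparing right derivatives there yields CD for finitely supported f
(`GradientEstimate.curvature_le`). That is enough, as CD at a vertex involves only vertices within
two steps. -/

open scoped InnerProductSpace

/-! ### Exponentials of bounded nonpositive symmetric operators, with bounds independent of the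
operator norm -/

section BoundedGenerator

variable {H : Type*} [NormedAddCommGroup H] [InnerProductSpace ℝ H]

/-- Bounded symmetric nonpositive operators. -/
structure IsSymmNonpos (A : H →L[ℝ] H) : Prop where
  symm : ∀ g h, ⟪A g, h⟫_ℝ = ⟪g, A h⟫_ℝ
  nonpos : ∀ g, ⟪A g, g⟫_ℝ ≤ 0

/-- The exponential `e^{tA}` of a bounded operator. -/
noncomputable def expOp (A : H →L[ℝ] H) (t : ℝ) : H →L[ℝ] H := NormedSpace.exp (t • A)

theorem expOp_zero (A : H →L[ℝ] H) : expOp A 0 = 1 := by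
  simp [expOp]

theorem expOp_commute {A B : H →L[ℝ] H} (h : Commute A B) (t : ℝ) : Commute (expOp A t) B :=
  (h.smul_left t).exp_left

theorem expOp_comm_apply {A B : H →L[ℝ] H} (h : Commute A B) (t : ℝ) (g : H) :
    expOp A t (B g) = B (expOp A t g) :=
  DFunLike.congr_fun (expOp_commute h t).eq g

variable [CompleteSpace H]

theorem expOp_add (A : H →L[ℝ] H) (s t : ℝ) (g : H) :
    expOp A (s + t) g = expOp A s (expOp A t g) := by
  have h : Commute (s • A) (t • A) := ((Commute.refl A).smul_left s).smul_right t
  let _ : NormedAlgebra ℚ (H →L[ℝ] H) := NormedAlgebra.restrictScalars ℚ ℝ _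
  rw [expOp, add_smul, NormedSpace.exp_add_of_commute h]
  rfl

theorem hasDerivAt_expOp (A : H →L[ℝ] H) (g : H) (t : ℝ) :
    HasDerivAt (fun s => expOp A s g) (A (expOp A t g)) t := by
  have h := (hasDerivAt_exp_smul_const' (𝕂 := ℝ) A t).clm_apply (hasDerivAt_const t g)
  simpa [expOp] using h

theorem IsSymmNonpos.expOp_symm {A : H →L[ℝ] H} (hA : IsSymmNonpos A) (t : ℝ) (g h : H) :
    ⟪expOp A t g, h⟫_ℝ = ⟪g, expOp A t h⟫_ℝ := by
  have hs : IsSelfAdjoint A :=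
    ContinuousLinearMap.isSelfAdjoint_iff_isSymmetric.2 fun x y => hA.symm x y
  have h2 : IsSelfAdjoint (expOp A t) := by
    have := (IsSelfAdjoint.smul (IsSelfAdjoint.all t) hs)
    exact this.exp
  exact (ContinuousLinearMap.isSelfAdjoint_iff_isSymmetric.1 h2) g h

/-- The Lyapunov function `‖u‖² - 2s⟨Au, u⟩ + 2s²‖Au‖²` decreases along `u = e^{sA} g`. -/
theorem IsSymmNonpos.lyapunov {A : H →L[ℝ] H} (hA : IsSymmNonpos A) {t : ℝ} (ht : 0 ≤ t) (g : H) :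
    ‖expOp A t g‖ ^ 2 - 2 * t * ⟪A (expOp A t g), expOp A t g⟫_ℝ
      + 2 * t ^ 2 * ‖A (expOp A t g)‖ ^ 2 ≤ ‖g‖ ^ 2 := by
  set u : ℝ → H := fun s => expOp A s g with hu
  have hd : ∀ s, HasDerivAt u (A (u s)) s := hasDerivAt_expOp A g
  have hd2 : ∀ s, HasDerivAt (fun s => A (u s)) (A (A (u s))) s := fun s =>
    A.hasFDerivAt.comp_hasDerivAt s (hd s)
  set F : ℝ → ℝ := fun s => ⟪u s, u s⟫_ℝ - 2 * s * ⟪A (u s), u s⟫_ℝ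
      + 2 * s ^ 2 * ⟪A (u s), A (u s)⟫_ℝ with hF
  have hFd : ∀ s, HasDerivAt F (4 * s ^ 2 * ⟪A (A (u s)), A (u s)⟫_ℝ) s := by
    intro s
    have h1 := (hd s).inner ℝ (hd s)
    have h2 := ((hasDerivAt_id s).const_mul 2).mul ((hd2 s).inner ℝ (hd s))
    have h3 := (((hasDerivAt_id s).pow 2).const_mul 2).mul ((hd2 s).inner ℝ (hd2 s))
    refine ((h1.sub h2).add h3).congr_deriv ?_
    simp only [id, Pi.pow_apply, hA.symm (A (u s)) (u s), real_inner_comm (A (u s)) (u s),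
      real_inner_comm (A (u s)) (A (A (u s)))]
    ring
  have hanti : AntitoneOn F (Set.Ici 0) := by
    refine antitoneOn_of_deriv_nonpos (convex_Ici 0)
      (fun s _ => (hFd s).continuousAt.continuousWithinAt)
      (fun s _ => (hFd s).differentiableAt.differentiableWithinAt) fun s _ => ?_
    rw [(hFd s).deriv]
    exact mul_nonpos_of_nonneg_of_nonpos (by positivity) (hA.nonpos _)
  have := hanti (Set.mem_Ici.2 le_rfl) (Set.mem_Ici.2 ht) ht
  simpa [hF, hu, expOp_zero, real_inner_self_eq_norm_sq] using this

theorem IsSymmNonpos.norm_expOp_le {A : H →L[ℝ] H} (hA : IsSymmNonpos A) {t : ℝ} (ht : 0 ≤ t)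
    (g : H) : ‖expOp A t g‖ ≤ ‖g‖ := by
  have h := hA.lyapunov ht g
  have h1 := hA.nonpos (expOp A t g)
  refine abs_le_of_sq_le_sq' ?_ (norm_nonneg _) |>.2
  have : 0 ≤ 2 * t ^ 2 * ‖A (expOp A t g)‖ ^ 2 := by positivity
  nlinarith [mul_nonneg ht (neg_nonneg.2 h1)]

/-- The last term of the Lyapunov function alone controls t‖Au‖. The bound does not see ‖A‖, so it
survives the Yosida limit. -/
theorem IsSymmNonpos.norm_apply_expOp_le {A : H →L[ℝ] H} (hA : IsSymmNonpos A) {t : ℝ}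
    (ht : 0 < t) (g : H) : ‖A (expOp A t g)‖ ≤ t⁻¹ * ‖g‖ := by
  have h := hA.lyapunov ht.le g
  have h1 := hA.nonpos (expOp A t g)
  have h2 : t * ‖A (expOp A t g)‖ ≤ ‖g‖ := by
    refine abs_le_of_sq_le_sq' ?_ (norm_nonneg _) |>.2
    have : 0 ≤ t ^ 2 * ‖A (expOp A t g)‖ ^ 2 := by positivity
    nlinarith [mul_nonneg ht.le (neg_nonneg.2 h1), sq_nonneg ‖expOp A t g‖]
  rw [inv_mul_eq_div, le_div_iff₀ ht]
  linarith

theorem IsSymmNonpos.neg_inner_expOp_le {A : H →L[ℝ] H} (hA : IsSymmNonpos A) {t : ℝ}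
    (ht : 0 ≤ t) (g : H) : -⟪A (expOp A t g), expOp A t g⟫_ℝ ≤ -⟪A g, g⟫_ℝ := by
  set u : ℝ → H := fun s => expOp A s g with hu
  have hd : ∀ s, HasDerivAt u (A (u s)) s := hasDerivAt_expOp A g
  have hd2 : ∀ s, HasDerivAt (fun s => A (u s)) (A (A (u s))) s := fun s =>
    A.hasFDerivAt.comp_hasDerivAt s (hd s)
  set F : ℝ → ℝ := fun s => -⟪A (u s), u s⟫_ℝ with hF
  have hFd : ∀ s, HasDerivAt F (-(2 * ‖A (u s)‖ ^ 2)) s := by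
    intro s
    refine ((hd2 s).inner ℝ (hd s)).neg.congr_deriv ?_
    rw [hA.symm (A (u s)) (u s), real_inner_self_eq_norm_sq]
    ring
  have hanti : AntitoneOn F (Set.Ici 0) := by
    refine antitoneOn_of_deriv_nonpos (convex_Ici 0)
      (fun s _ => (hFd s).continuousAt.continuousWithinAt)
      (fun s _ => (hFd s).differentiableAt.differentiableWithinAt) fun s _ => ?_
    rw [(hFd s).deriv]
    simp only [Left.neg_nonpos_iff]
    positivity
  have := hanti (Set.mem_Ici.2 le_rfl) (Set.mem_Ici.2 ht) ht
  simpa [hF, hu, expOp_zero] using this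

/-- Interpolate by e^{sA} e^{(t-s)B} g: since `A` and `B` commute, its derivative is the image of Ag
- Bg under two contractions. This is the Cauchy estimate behind Hille–Yosida. -/
theorem IsSymmNonpos.norm_expOp_sub_expOp_le {A B : H →L[ℝ] H} (hA : IsSymmNonpos A)
    (hB : IsSymmNonpos B) (hAB : Commute A B) {t : ℝ} (ht : 0 ≤ t) (g : H) :
    ‖expOp A t g - expOp B t g‖ ≤ t * ‖A g - B g‖ := by
  set F : ℝ → H := fun s => expOp A s (expOp B (t - s) g) with hF
  have hFd : ∀ s, HasDerivAt F (expOp A s (expOp B (t - s) (A g - B g))) s := by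
    intro s
    have h1 : HasDerivAt (fun s => expOp B (t - s) g) (-(B (expOp B (t - s) g))) s := by
      simpa [Function.comp_def] using
        (hasDerivAt_expOp B g (t - s)).scomp s ((hasDerivAt_id s).const_sub t)
    have h0 : HasDerivAt (fun u => expOp A u) (A * expOp A s) s :=
      hasDerivAt_exp_smul_const' (𝕂 := ℝ) A s
    refine (h0.clm_apply h1).congr_deriv ?_
    simp only [map_sub, map_neg]
    rw [expOp_comm_apply hAB.symm, expOp_comm_apply (Commute.refl B),
      expOp_comm_apply (Commute.refl A)]
    simp [sub_eq_add_neg]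
  have := (convex_Icc (0 : ℝ) t).norm_image_sub_le_of_norm_hasDerivWithin_le
    (f := F) (C := ‖A g - B g‖) (fun s _ => (hFd s).hasDerivWithinAt)
    (fun s hs => (hA.norm_expOp_le hs.1 _).trans (hB.norm_expOp_le (by linarith [hs.2]) _))
    (Set.left_mem_Icc.2 ht) (Set.right_mem_Icc.2 ht)
  simpa [hF, expOp_zero, abs_of_nonneg ht, mul_comm] using this

/-- A second-order Taylor estimate: ‖A² e^{sA} g‖ decreases in `s`, so its value at the earlier time
`c` dominates. Taking c > 0 exploits smoothing, while c = 0 serves vectors in the domain of the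
squared generator. -/
theorem IsSymmNonpos.norm_expOp_sub_sub_le {A : H →L[ℝ] H} (hA : IsSymmNonpos A) {a b c : ℝ}
    (ha : c ≤ a) (hb : c ≤ b) (g : H) :
    ‖expOp A b g - expOp A a g - (b - a) • A (expOp A a g)‖
      ≤ (b - a) ^ 2 * ‖A (A (expOp A c g))‖ := by
  have hd : ∀ s, HasDerivAt (fun s => expOp A s g) (A (expOp A s g)) s := hasDerivAt_expOp A g
  have hd2 : ∀ s, HasDerivAt (fun s => A (expOp A s g)) (A (A (expOp A s g))) s := fun s =>
    A.hasFDerivAt.comp_hasDerivAt s (hd s)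
  have hsub : Set.uIcc a b ⊆ Set.Ici c := fun s hs => (le_inf ha hb).trans hs.1
  have hbound : ∀ s ∈ Set.uIcc a b, ‖A (A (expOp A s g))‖ ≤ ‖A (A (expOp A c g))‖ := by
    intro s hs
    have : expOp A s g = expOp A (s - c) (expOp A c g) := by
      rw [← expOp_add]; simp
    rw [this, ← expOp_comm_apply (Commute.refl A), ← expOp_comm_apply (Commute.refl A)]
    exact hA.norm_expOp_le (sub_nonneg.2 (hsub hs)) _
  have hC : ∀ s ∈ Set.uIcc a b, ‖A (expOp A s g) - A (expOp A a g)‖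
      ≤ |b - a| * ‖A (A (expOp A c g))‖ := by
    intro s hs
    have := (convex_uIcc a b).norm_image_sub_le_of_norm_hasDerivWithin_le
      (f := fun s => A (expOp A s g)) (fun s _ => (hd2 s).hasDerivWithinAt)
      hbound Set.left_mem_uIcc hs
    refine this.trans ?_
    rw [mul_comm, Real.norm_eq_abs]
    gcongr ?_ * _
    exact Set.abs_sub_left_of_mem_uIcc hs
  have := (convex_uIcc a b).norm_image_sub_le_of_norm_hasDerivWithin_le
    (f := fun s => expOp A s g - s • A (expOp A a g))
    (f' := fun s => A (expOp A s g) - A (expOp A a g))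
    (fun s _ => by
      have h := (hd s).sub ((hasDerivAt_id s).smul_const (A (expOp A a g)))
      rw [one_smul] at h
      exact h.hasDerivWithinAt)
    hC Set.left_mem_uIcc Set.right_mem_uIcc
  calc _ = ‖expOp A b g - b • A (expOp A a g) - (expOp A a g - a • A (expOp A a g))‖ := by
        congr 1; rw [sub_smul]; abel
    _ ≤ _ := this
    _ = _ := by rw [Real.norm_eq_abs, mul_right_comm, ← sq, sq_abs]

end BoundedGenerator

/-! ### Strong limits of uniformly bounded operators -/

section StrongConvergence

variable {H F : Type*} [NormedAddCommGroup H] [NormedSpace ℝ H] [NormedAddCommGroup F]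
  [NormedSpace ℝ F] {ι : Type*} {l : Filter ι} {T : ι → H →L[ℝ] F} {C : ℝ}

theorem tendsto_apply_of_bounded {T₀ : H →L[ℝ] F} {x : ι → H} {x₀ : H}
    (hT : ∀ᶠ i in l, ∀ g, ‖T i g‖ ≤ C * ‖g‖) (h : Tendsto (fun i => T i x₀) l (𝓝 (T₀ x₀)))
    (hx : Tendsto x l (𝓝 x₀)) : Tendsto (fun i => T i (x i)) l (𝓝 (T₀ x₀)) := by
  have h1 : Tendsto (fun i => T i (x i) - T i x₀) l (𝓝 0) := by
    refine squeeze_zero_norm' (a := fun i => C * ‖x i - x₀‖) ?_ ?_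
    · filter_upwards [hT] with i hi
      rw [← map_sub]
      exact hi _
    · simpa using (tendsto_iff_norm_sub_tendsto_zero.1 hx).const_mul C
  simpa using h1.add h

theorem tendsto_of_dense {T₀ : H →L[ℝ] F} {S : Set H} (hS : Dense S)
    (hT : ∀ᶠ i in l, ∀ g, ‖T i g‖ ≤ C * ‖g‖)
    (h : ∀ g ∈ S, Tendsto (fun i => T i g) l (𝓝 (T₀ g))) (g : H) :
    Tendsto (fun i => T i g) l (𝓝 (T₀ g)) := by
  rw [Metric.tendsto_nhds]
  intro ε hε
  set B := |C| + ‖T₀‖ + 1 with hB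
  have hBpos : 0 < B := by positivity
  obtain ⟨y, hyS, hy⟩ := hS.exists_dist_lt g (div_pos (half_pos hε) hBpos)
  filter_upwards [hT, Metric.tendsto_nhds.1 (h y hyS) (ε / 2) (half_pos hε)] with i hi h2
  rw [dist_eq_norm] at *
  have e : T i g - T₀ g = T i (g - y) + (T i y - T₀ y) - T₀ (g - y) := by
    simp only [map_sub]; abel
  rw [lt_div_iff₀ hBpos] at hy
  calc ‖T i g - T₀ g‖ ≤ ‖T i (g - y)‖ + ‖T i y - T₀ y‖ + ‖T₀ (g - y)‖ := by
        rw [e]; exact (norm_sub_le _ _).trans (add_le_add_left (norm_add_le _ _) _)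
    _ ≤ |C| * ‖g - y‖ + ‖T i y - T₀ y‖ + ‖T₀‖ * ‖g - y‖ := by
        gcongr
        · exact (hi _).trans (mul_le_mul_of_nonneg_right (le_abs_self C) (norm_nonneg _))
        · exact T₀.le_opNorm _
    _ < ε := by nlinarith [norm_nonneg (g - y)]

theorem exists_limit_of_dense [CompleteSpace F] [l.NeBot] {S : Set H} (hS : Dense S)
    (hC : 0 ≤ C) (hT : ∀ᶠ i in l, ∀ g, ‖T i g‖ ≤ C * ‖g‖)
    (h : ∀ g ∈ S, ∃ y, Tendsto (fun i => T i g) l (𝓝 y)) :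
    ∃ T₀ : H →L[ℝ] F, (∀ g, ‖T₀ g‖ ≤ C * ‖g‖) ∧
      ∀ g, Tendsto (fun i => T i g) l (𝓝 (T₀ g)) := by
  have key : ∀ g, ∃ y, Tendsto (fun i => T i g) l (𝓝 y) := by
    intro g
    suffices Cauchy (map (fun i => T i g) l) from cauchy_map_iff_exists_tendsto.1 this
    rw [Metric.cauchy_iff]
    refine ⟨inferInstance, fun ε hε => ?_⟩
    obtain ⟨y, hyS, hy⟩ := hS.exists_dist_lt g (div_pos hε (by positivity : 0 < 4 * (C + 1)))
    obtain ⟨z, hz⟩ := h y hyS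
    have hev : ∀ᶠ i in l, ‖T i g - z‖ < ε / 2 := by
      filter_upwards [hT, Metric.tendsto_nhds.1 hz (ε / 4) (by positivity)] with i hi h2
      rw [dist_eq_norm] at *
      rw [lt_div_iff₀ (by positivity)] at hy
      have e : T i g - z = T i (g - y) + (T i y - z) := by simp
      rw [e]
      refine (norm_add_le _ _).trans_lt ?_
      nlinarith [hi (g - y), norm_nonneg (g - y)]
    refine ⟨(fun i => T i g) '' {i | ‖T i g - z‖ < ε / 2}, image_mem_map hev, ?_⟩
    rintro _ ⟨i, hi, rfl⟩ _ ⟨j, hj, rfl⟩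
    rw [Set.mem_ofPred_eq, ← dist_eq_norm] at hi hj
    have := dist_triangle_right (T i g) (T j g) z
    change dist (T i g) (T j g) < ε
    linarith
  choose f hf using key
  let T₁ : H →ₗ[ℝ] F :=
    { toFun := f
      map_add' := fun a b => tendsto_nhds_unique (hf (a + b)) (by
        simpa using (hf a).add (hf b))
      map_smul' := fun c a => tendsto_nhds_unique (hf (c • a)) (by
        simpa using (hf a).const_smul c) }
  have hb : ∀ g, ‖T₁ g‖ ≤ C * ‖g‖ := fun g =>
    le_of_tendsto (hf g).norm (by filter_upwards [hT] with i hi using hi g)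
  exact ⟨T₁.mkContinuous C hb, hb, hf⟩

end StrongConvergence

/-! ### Hille–Yosida theory for self-adjoint nonpositive operators -/

/-- Graphs `L` of nonpositive self-adjoint operators (possibly unbounded), in terms of the
solvability of the resolvent equation. -/
structure IsSelfAdjNonpos {H : Type*} [NormedAddCommGroup H] [InnerProductSpace ℝ H]
    (L : Submodule ℝ (H × H)) : Prop where
  symm : ∀ p ∈ L, ∀ q ∈ L, ⟪p.2, q.1⟫_ℝ = ⟪p.1, q.2⟫_ℝ
  nonpos : ∀ p ∈ L, ⟪p.2, p.1⟫_ℝ ≤ 0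
  surj : ∀ α : ℝ, 0 < α → ∀ g, ∃ u, (u, α • u - g) ∈ L
  dense : Dense {u | ∃ w, (u, w) ∈ L}

namespace IsSelfAdjNonpos

variable {H : Type*} [NormedAddCommGroup H] [InnerProductSpace ℝ H]
  {L : Submodule ℝ (H × H)} (hL : IsSelfAdjNonpos L)

include hL

/-- Pair the resolvent equation with `u`: nonpositivity leaves α‖u‖² ≤ ⟨g, u⟩. -/
theorem norm_le_of_mem {α : ℝ} (hα : 0 < α) {u g : H} (h : (u, α • u - g) ∈ L) :
    ‖u‖ ≤ α⁻¹ * ‖g‖ := by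
  have h1 := hL.nonpos _ h
  simp only [inner_sub_left, inner_smul_left, real_inner_self_eq_norm_sq, RCLike.conj_to_real] at h1
  have h2 := real_inner_le_norm g u
  rw [inv_mul_eq_div, le_div_iff₀ hα]
  by_contra! h3
  have h4 : 0 < ‖u‖ := by
    by_contra! h5
    nlinarith [norm_nonneg g, norm_nonneg u]
  nlinarith

theorem unique_of_mem {α : ℝ} (hα : 0 < α) {u v g : H} (h : (u, α • u - g) ∈ L)
    (h' : (v, α • v - g) ∈ L) : u = v := by
  have h1 : (u - v, α • (u - v) - (0 : H)) ∈ L := by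
    have := L.sub_mem h h'
    convert this using 1
    simp [smul_sub]
  have := hL.norm_le_of_mem hα h1
  rw [← sub_eq_zero, ← norm_le_zero_iff]
  simpa using this

theorem exists_resolvent {α : ℝ} (hα : 0 < α) :
    ∃ R : H →L[ℝ] H, ∀ g, (R g, α • R g - g) ∈ L := by
  choose f hf using hL.surj α hα
  let R : H →ₗ[ℝ] H :=
    { toFun := f
      map_add' := fun a b => hL.unique_of_mem hα (hf (a + b)) (by
        convert L.add_mem (hf a) (hf b) using 1
        simp only [Prod.mk_add_mk, smul_add, Prod.mk.injEq, true_and]; abel)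
      map_smul' := fun c a => hL.unique_of_mem hα (hf (c • a)) (by
        convert L.smul_mem c (hf a) using 1
        rw [RingHom.id_apply, Prod.smul_mk, smul_sub, smul_comm α c]) }
  exact ⟨R.mkContinuous α⁻¹ fun g => hL.norm_le_of_mem hα (hf g), hf⟩

open Classical in
/-- The operator `α (α - L)⁻¹`. -/
noncomputable def J (α : ℝ) : H →L[ℝ] H :=
  if hα : 0 < α then α • (hL.exists_resolvent hα).choose else 0

/-- The Yosida approximation `α (α (α - L)⁻¹ - 1)`. -/
noncomputable def A (α : ℝ) : H →L[ℝ] H := α • (hL.J α - 1)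

variable {α β : ℝ}

theorem A_apply (α : ℝ) (g : H) : hL.A α g = α • (hL.J α g - g) := rfl

theorem resolvent_mem (hα : 0 < α) (g : H) :
    (α⁻¹ • hL.J α g, α • (α⁻¹ • hL.J α g) - g) ∈ L := by
  have : α⁻¹ • hL.J α g = (hL.exists_resolvent hα).choose g := by
    simp [J, hα, smul_smul, hα.ne']
  rw [this]
  exact (hL.exists_resolvent hα).choose_spec g

theorem J_mem (hα : 0 < α) (g : H) : (hL.J α g, hL.A α g) ∈ L := by
  have := L.smul_mem α (hL.resolvent_mem hα g)
  simpa [A, smul_smul, hα.ne'] using this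

theorem norm_J_le (hα : 0 < α) (g : H) : ‖hL.J α g‖ ≤ ‖g‖ := by
  have := hL.norm_le_of_mem hα (hL.resolvent_mem hα g)
  rw [norm_smul, norm_inv, Real.norm_of_nonneg hα.le] at this
  exact le_of_mul_le_mul_left this (inv_pos.2 hα)

theorem J_eq_of_mem (hα : 0 < α) {u w g : H} (h : (u, w) ∈ L) (hg : w = α • (u - g)) :
    hL.J α g = u := by
  have h1 : (α⁻¹ • u, α • (α⁻¹ • u) - g) ∈ L := by
    have := L.smul_mem α⁻¹ h
    simpa [hg, smul_smul, hα.ne'] using this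
  have := hL.unique_of_mem hα (hL.resolvent_mem hα g) h1
  exact smul_right_injective H (inv_ne_zero hα.ne') this

/-- On the domain the Yosida approximation is the resolvent average of Lu, so it converges to Lu as
soon as J_α → 1 strongly. -/
theorem A_eq_J (hα : 0 < α) {u w : H} (h : (u, w) ∈ L) : hL.A α u = hL.J α w := by
  have h1 : hL.J α (u - α⁻¹ • w) = u := hL.J_eq_of_mem hα h (by simp [smul_smul, hα.ne'])
  rw [map_sub, map_smul] at h1
  rw [A_apply]
  have h2 : hL.J α u - u = α⁻¹ • hL.J α w := by
    rw [sub_eq_iff_eq_add] at h1 ⊢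
    rw [h1]
    conv_lhs => rw [add_comm]
  rw [h2, smul_smul, mul_inv_cancel₀ hα.ne', one_smul]

theorem J_eq (hα : 0 < α) (g : H) : hL.J α g = g + α⁻¹ • hL.A α g := by
  simp [A_apply, smul_smul, hα.ne']

theorem isSymmNonpos_A (hα : 0 < α) : IsSymmNonpos (hL.A α) where
  symm g h := by
    have := hL.symm _ (hL.J_mem hα g) _ (hL.J_mem hα h)
    simp only [hL.J_eq hα, inner_add_left, inner_add_right, inner_smul_left, inner_smul_right,
      RCLike.conj_to_real] at this
    linarith
  nonpos g := by
    have := hL.nonpos _ (hL.J_mem hα g)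
    simp only [hL.J_eq hα, inner_add_right, inner_smul_right, real_inner_self_eq_norm_sq] at this
    have : 0 ≤ α⁻¹ * ‖hL.A α g‖ ^ 2 := by positivity
    linarith

theorem J_comm (hα : 0 < α) (hβ : 0 < β) (g : H) :
    hL.J α (hL.J β g) = hL.J β (hL.J α g) := by
  refine hL.J_eq_of_mem hα (hL.J_mem hβ (hL.J α g)) ?_
  rw [hL.A_eq_J hβ (hL.J_mem hα g), A_apply, map_smul, map_sub]

theorem A_commute (hα : 0 < α) (hβ : 0 < β) : Commute (hL.A α) (hL.A β) := by
  have h : Commute (hL.J α) (hL.J β) := ContinuousLinearMap.ext fun g => hL.J_comm hα hβ g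
  exact ((h.sub_right (Commute.one_right _)).sub_left (Commute.one_left _)).smul_left α
    |>.smul_right β

theorem A_commute_J (hα : 0 < α) (hβ : 0 < β) : Commute (hL.A α) (hL.J β) := by
  have h : Commute (hL.J α) (hL.J β) := ContinuousLinearMap.ext fun g => hL.J_comm hα hβ g
  exact (h.sub_left (Commute.one_left _)).smul_left α

theorem tendsto_J (g : H) : Tendsto (fun α => hL.J α g) atTop (𝓝 g) := by
  refine tendsto_of_dense (T := hL.J) (T₀ := ContinuousLinearMap.id ℝ H) (C := 1) hL.dense ?_ ?_ g
  · filter_upwards [eventually_gt_atTop 0] with α hα g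
    simpa using hL.norm_J_le hα g
  · rintro u ⟨w, h⟩
    rw [tendsto_iff_norm_sub_tendsto_zero]
    refine squeeze_zero_norm' (a := fun α : ℝ => α⁻¹ * ‖w‖) ?_ ?_
    · filter_upwards [eventually_gt_atTop 0] with α hα
      rw [norm_norm, hL.J_eq hα, hL.A_eq_J hα h]
      simp only [ContinuousLinearMap.coe_id', id_eq, add_sub_cancel_left, norm_smul, norm_inv,
        Real.norm_of_nonneg hα.le]
      exact mul_le_mul_of_nonneg_left (hL.norm_J_le hα w) (inv_nonneg.2 hα.le)
    · simpa using tendsto_inv_atTop_zero.mul_const ‖w‖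

theorem tendsto_A {u w : H} (h : (u, w) ∈ L) : Tendsto (fun α => hL.A α u) atTop (𝓝 w) := by
  refine (hL.tendsto_J w).congr' ?_
  filter_upwards [eventually_gt_atTop 0] with α hα
  rw [hL.A_eq_J hα h]

/-- The graph is closed because membership of (u, w) is equivalent to the continuous condition J_1(u
- w) = u. -/
theorem mem_of_tendsto {u w : ℝ → H} {u₀ w₀ : H} (h : ∀ᶠ α in atTop, (u α, w α) ∈ L)
    (hu : Tendsto u atTop (𝓝 u₀)) (hw : Tendsto w atTop (𝓝 w₀)) : (u₀, w₀) ∈ L := by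
  have h1 : Tendsto (fun α => hL.J 1 (u α - w α)) atTop (𝓝 (hL.J 1 (u₀ - w₀))) :=
    ((hL.J 1).continuous.tendsto _).comp (hu.sub hw)
  have h2 : hL.J 1 (u₀ - w₀) = u₀ := by
    refine tendsto_nhds_unique h1 (hu.congr' ?_)
    filter_upwards [h] with α hα
    exact (hL.J_eq_of_mem one_pos hα (by simp)).symm
  have h3 := hL.J_mem one_pos (u₀ - w₀)
  rw [A_apply, h2] at h3
  simpa using h3

variable [CompleteSpace H]

theorem exists_semigroup {t : ℝ} (ht : 0 ≤ t) :
    ∃ T : H →L[ℝ] H, (∀ g, ‖T g‖ ≤ 1 * ‖g‖) ∧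
      ∀ g, Tendsto (fun α => expOp (hL.A α) t g) atTop (𝓝 (T g)) := by
  refine exists_limit_of_dense hL.dense zero_le_one ?_ ?_
  · filter_upwards [eventually_gt_atTop 0] with α hα g
    simpa using (hL.isSymmNonpos_A hα).norm_expOp_le ht g
  · rintro u ⟨w, h⟩
    refine cauchy_map_iff_exists_tendsto.1 ?_
    have hc := (hL.tendsto_A h).cauchy_map
    rw [Metric.cauchy_iff] at hc ⊢
    refine ⟨inferInstance, fun ε hε => ?_⟩
    obtain ⟨s, hs, h2⟩ := hc.2 (ε / (t + 1)) (by positivity)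
    refine ⟨(fun α => expOp (hL.A α) t u) '' ({α | hL.A α u ∈ s} ∩ {α | 0 < α}),
      image_mem_map (inter_mem hs (eventually_gt_atTop 0)), ?_⟩
    rintro _ ⟨α, ⟨hα, hα0⟩, rfl⟩ _ ⟨β, ⟨hβ, hβ0⟩, rfl⟩
    have h3 := h2 _ hα _ hβ
    rw [lt_div_iff₀ (by positivity), dist_eq_norm] at h3
    rw [dist_eq_norm]
    have := (hL.isSymmNonpos_A hα0).norm_expOp_sub_expOp_le (hL.isSymmNonpos_A hβ0)
      (hL.A_commute hα0 hβ0) ht u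
    nlinarith [norm_nonneg (hL.A α u - hL.A β u)]

open Classical in
/-- The contraction semigroup generated by `L`. -/
noncomputable def P (t : ℝ) : H →L[ℝ] H :=
  if ht : 0 ≤ t then (hL.exists_semigroup ht).choose else 0

theorem norm_P_le {t : ℝ} (ht : 0 ≤ t) (g : H) : ‖hL.P t g‖ ≤ ‖g‖ := by
  have := (hL.exists_semigroup ht).choose_spec.1 g
  simpa [P, ht] using this

theorem tendsto_P {t : ℝ} (ht : 0 ≤ t) (g : H) :
    Tendsto (fun α => expOp (hL.A α) t g) atTop (𝓝 (hL.P t g)) := by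
  have := (hL.exists_semigroup ht).choose_spec.2 g
  simpa [P, ht] using this

theorem eventually_norm_expOp_le {t : ℝ} (ht : 0 ≤ t) :
    ∀ᶠ α in atTop, ∀ g, ‖expOp (hL.A α) t g‖ ≤ 1 * ‖g‖ := by
  filter_upwards [eventually_gt_atTop 0] with α hα g
  simpa using (hL.isSymmNonpos_A hα).norm_expOp_le ht g

theorem tendsto_P_of_tendsto {t : ℝ} (ht : 0 ≤ t) {x : ℝ → H} {g : H}
    (hx : Tendsto x atTop (𝓝 g)) :
    Tendsto (fun α => expOp (hL.A α) t (x α)) atTop (𝓝 (hL.P t g)) :=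
  tendsto_apply_of_bounded (hL.eventually_norm_expOp_le ht) (hL.tendsto_P ht g) hx

theorem P_zero (g : H) : hL.P 0 g = g :=
  tendsto_nhds_unique (hL.tendsto_P le_rfl g) (by simp [expOp_zero])

theorem P_add {s t : ℝ} (hs : 0 ≤ s) (ht : 0 ≤ t) (g : H) :
    hL.P (s + t) g = hL.P s (hL.P t g) := by
  refine tendsto_nhds_unique (hL.tendsto_P (add_nonneg hs ht) g) ?_
  simp only [expOp_add]
  exact hL.tendsto_P_of_tendsto hs (hL.tendsto_P ht g)

theorem P_symm {t : ℝ} (ht : 0 ≤ t) (g h : H) : ⟪hL.P t g, h⟫_ℝ = ⟪g, hL.P t h⟫_ℝ := by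
  refine tendsto_nhds_unique ((hL.tendsto_P ht g).inner tendsto_const_nhds) ?_
  refine ((tendsto_const_nhds (x := g)).inner (hL.tendsto_P ht h)).congr' ?_
  filter_upwards [eventually_gt_atTop 0] with α hα
  exact ((hL.isSymmNonpos_A hα).expOp_symm t g h).symm

/-- The pairs (J_α v, A_α v) with v = e^{tA_α} u lie in the closed graph and converge to the
required pair. -/
theorem P_mem {t : ℝ} (ht : 0 ≤ t) {u w : H} (h : (u, w) ∈ L) : (hL.P t u, hL.P t w) ∈ L := by
  refine hL.mem_of_tendsto (u := fun α => hL.J α (expOp (hL.A α) t u))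
    (w := fun α => hL.A α (expOp (hL.A α) t u)) ?_ ?_ ?_
  · filter_upwards [eventually_gt_atTop 0] with α hα using hL.J_mem hα _
  · refine (hL.tendsto_P_of_tendsto ht (hL.tendsto_J u)).congr' ?_
    filter_upwards [eventually_gt_atTop 0] with α hα
    exact expOp_comm_apply (hL.A_commute_J hα hα) t u
  · simp only [← expOp_comm_apply (Commute.refl _)]
    exact hL.tendsto_P_of_tendsto ht (hL.tendsto_A h)

theorem neg_inner_P_le {t : ℝ} (ht : 0 ≤ t) {u w : H} (h : (u, w) ∈ L) :
    -⟪hL.P t w, hL.P t u⟫_ℝ ≤ -⟪w, u⟫_ℝ := by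
  refine le_of_tendsto_of_tendsto
    ((hL.tendsto_P_of_tendsto ht (hL.tendsto_A h)).inner (hL.tendsto_P ht u)).neg
    ((hL.tendsto_A h).inner tendsto_const_nhds).neg ?_
  filter_upwards [eventually_gt_atTop 0] with α hα
  rw [expOp_comm_apply (Commute.refl _)]
  exact (hL.isSymmNonpos_A hα).neg_inner_expOp_le ht u

theorem norm_P_sub_sub_le {t : ℝ} (ht : 0 ≤ t) {u w z : H} (h : (u, w) ∈ L) (h' : (w, z) ∈ L) :
    ‖hL.P t u - u - t • w‖ ≤ t ^ 2 * ‖z‖ := by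
  refine le_of_tendsto_of_tendsto
    (((hL.tendsto_P ht u).sub_const u).sub ((hL.tendsto_A h).const_smul t)).norm
    ((hL.tendsto_J z).norm.const_mul (t ^ 2)) ?_
  filter_upwards [eventually_gt_atTop 0] with α hα
  have := (hL.isSymmNonpos_A hα).norm_expOp_sub_sub_le le_rfl ht u
  simp only [expOp_zero, one_apply_eq_self, sub_zero] at this
  refine this.trans ?_
  gcongr
  have e : hL.A α (hL.A α u) = hL.J α (hL.J α z) := by
    rw [hL.A_eq_J hα h, ← hL.A_eq_J hα h']
    exact DFunLike.congr_fun (hL.A_commute_J hα hα).eq w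
  rw [e]
  exact hL.norm_J_le hα _

/-- The limit exists on the domain, and the smoothing bound 1/t, uniform in `α`, extends it to the
whole space. -/
theorem exists_generator_P {t : ℝ} (ht : 0 < t) :
    ∃ T : H →L[ℝ] H, (∀ g, ‖T g‖ ≤ t⁻¹ * ‖g‖) ∧
      ∀ g, Tendsto (fun α => hL.A α (expOp (hL.A α) t g)) atTop (𝓝 (T g)) := by
  refine exists_limit_of_dense (T := fun α => (hL.A α).comp (expOp (hL.A α) t)) hL.dense
    (inv_nonneg.2 ht.le) ?_ ?_
  · filter_upwards [eventually_gt_atTop 0] with α hα g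
    exact (hL.isSymmNonpos_A hα).norm_apply_expOp_le ht g
  · rintro u ⟨w, h⟩
    refine ⟨hL.P t w, ?_⟩
    simp only [ContinuousLinearMap.comp_apply, ← expOp_comm_apply (Commute.refl _)]
    exact hL.tendsto_P_of_tendsto ht.le (hL.tendsto_A h)

open Classical in
/-- The operators `L e^{tL}`, `t > 0`. -/
noncomputable def D (t : ℝ) : H →L[ℝ] H :=
  if ht : 0 < t then (hL.exists_generator_P ht).choose else 0

theorem norm_D_le {t : ℝ} (ht : 0 < t) (g : H) : ‖hL.D t g‖ ≤ t⁻¹ * ‖g‖ := by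
  have := (hL.exists_generator_P ht).choose_spec.1 g
  simpa [D, ht] using this

theorem tendsto_D {t : ℝ} (ht : 0 < t) (g : H) :
    Tendsto (fun α => hL.A α (expOp (hL.A α) t g)) atTop (𝓝 (hL.D t g)) := by
  have := (hL.exists_generator_P ht).choose_spec.2 g
  simpa [D, ht] using this

theorem D_mem {t : ℝ} (ht : 0 < t) (g : H) : (hL.P t g, hL.D t g) ∈ L := by
  refine hL.mem_of_tendsto (u := fun α => hL.J α (expOp (hL.A α) t g))
    (w := fun α => hL.A α (expOp (hL.A α) t g)) ?_ ?_ (hL.tendsto_D ht g)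
  · filter_upwards [eventually_gt_atTop 0] with α hα using hL.J_mem hα _
  · refine (hL.tendsto_P_of_tendsto ht.le (hL.tendsto_J g)).congr' ?_
    filter_upwards [eventually_gt_atTop 0] with α hα
    exact expOp_comm_apply (hL.A_commute_J hα hα) t g

theorem D_add {s t : ℝ} (hs : 0 < s) (ht : 0 ≤ t) (g : H) :
    hL.D (s + t) g = hL.D s (hL.P t g) := by
  refine tendsto_nhds_unique (hL.tendsto_D (by positivity) g) ?_
  simp only [expOp_add]
  refine tendsto_apply_of_bounded (T := fun α => (hL.A α).comp (expOp (hL.A α) s)) (C := s⁻¹)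
    ?_ (hL.tendsto_D hs _) (hL.tendsto_P ht g)
  filter_upwards [eventually_gt_atTop 0] with α hα g
  exact (hL.isSymmNonpos_A hα).norm_apply_expOp_le hs g

theorem D_add' {s t : ℝ} (hs : 0 ≤ s) (ht : 0 < t) (g : H) :
    hL.D (s + t) g = hL.P s (hL.D t g) := by
  refine tendsto_nhds_unique (hL.tendsto_D (by positivity) g) ?_
  simp only [expOp_add, ← expOp_comm_apply (Commute.refl _)]
  refine hL.tendsto_P_of_tendsto hs ?_
  simp only [expOp_comm_apply (Commute.refl _)]
  exact hL.tendsto_D ht g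

theorem norm_P_sub_P_sub_le {a b c : ℝ} (hc : 0 < c) (ha : c ≤ a) (hb : c ≤ b) (g : H) :
    ‖hL.P b g - hL.P a g - (b - a) • hL.D a g‖
      ≤ (b - a) ^ 2 * ((c / 2)⁻¹ * ((c / 2)⁻¹ * ‖g‖)) := by
  refine le_of_tendsto (((hL.tendsto_P (by linarith) g).sub (hL.tendsto_P (by linarith) g)).sub
    ((hL.tendsto_D (by linarith) g).const_smul (b - a))).norm ?_
  filter_upwards [eventually_gt_atTop 0] with α hα
  have hA := hL.isSymmNonpos_A hα
  refine (hA.norm_expOp_sub_sub_le ha hb g).trans ?_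
  gcongr
  -- Each of the two factors A_α is absorbed by half of the time `c`.
  have h1 : expOp (hL.A α) c g = expOp (hL.A α) (c / 2) (expOp (hL.A α) (c / 2) g) := by
    rw [← expOp_add, add_halves]
  rw [h1, ← expOp_comm_apply (Commute.refl _) (c / 2) (expOp (hL.A α) (c / 2) g)]
  refine (hA.norm_apply_expOp_le (half_pos hc) _).trans ?_
  gcongr
  exact hA.norm_apply_expOp_le (half_pos hc) _

theorem hasDerivAt_P {t : ℝ} (ht : 0 < t) (g : H) :
    HasDerivAt (fun s => hL.P s g) (hL.D t g) t := by
  rw [hasDerivAt_iff_isLittleO]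
  have h1 : (fun s => hL.P s g - hL.P t g - (s - t) • hL.D t g) =O[𝓝 t] fun s => (s - t) ^ 2 := by
    refine Asymptotics.IsBigO.of_bound ((t / 2 / 2)⁻¹ * ((t / 2 / 2)⁻¹ * ‖g‖)) ?_
    filter_upwards [eventually_gt_nhds (half_lt_self ht)] with s hs
    rw [mul_comm, norm_pow, Real.norm_eq_abs, sq_abs]
    exact hL.norm_P_sub_P_sub_le (half_pos ht) (half_le_self ht.le) hs.le g
  refine h1.trans_isLittleO ?_
  have : (fun s : ℝ => (s - t) ^ 2) =o[𝓝 t] fun s => (s - t) ^ 1 :=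
    (Asymptotics.isLittleO_pow_pow (by norm_num : 1 < 2)).comp_tendsto
      (by simpa using (tendsto_id (x := 𝓝 t)).sub_const t)
  simpa using this

theorem tendsto_P_zero (g : H) : Tendsto (fun t => hL.P t g) (𝓝[≥] 0) (𝓝 g) := by
  refine tendsto_of_dense (T := hL.P) (T₀ := ContinuousLinearMap.id ℝ H) (C := 1)
    (hL.dense) ?_ ?_ g
  · filter_upwards [self_mem_nhdsWithin] with t ht g
    simpa using hL.norm_P_le ht g
  · rintro u ⟨w, h⟩
    have hb : ∀ t : ℝ, 0 ≤ t → ‖hL.P t u - u‖ ≤ t * ‖w‖ := by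
      intro t ht
      refine le_of_tendsto_of_tendsto ((hL.tendsto_P ht u).sub_const u).norm
        ((hL.tendsto_A h).norm.const_mul t) ?_
      filter_upwards [eventually_gt_atTop 0] with α hα
      -- Comparison with the zero generator, whose semigroup is the identity, gives ‖P_t u - u‖ ≤
      -- t‖w‖.
      have h0 : IsSymmNonpos (0 : H →L[ℝ] H) := ⟨by simp, by simp⟩
      simpa [expOp] using (hL.isSymmNonpos_A hα).norm_expOp_sub_expOp_le h0
        (Commute.zero_right _) ht u
    rw [tendsto_iff_norm_sub_tendsto_zero]
    refine squeeze_zero' (g := fun t : ℝ => t * ‖w‖) (Eventually.of_forall fun _ => norm_nonneg _)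
      (by filter_upwards [self_mem_nhdsWithin] with t ht using hb t ht) ?_
    have : Tendsto (fun t : ℝ => t * ‖w‖) (𝓝 0) (𝓝 (0 * ‖w‖)) := tendsto_id.mul_const _
    rw [zero_mul] at this
    exact this.mono_left nhdsWithin_le_nhds

end IsSelfAdjNonpos

/-! ### Square summable families and bounded multiplication -/

section SquareSummable

/-- Real square summable families. -/
abbrev L2 (ι : Type*) := lp (fun _ : ι => ℝ) 2

variable {ι : Type*}

theorem memℓp_two_iff {f : ι → ℝ} : Memℓp f 2 ↔ Summable fun i => f i ^ 2 := by
  rw [memℓp_gen_iff (by norm_num)]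
  simp

/-- The element of `L2 ι` given by a square summable family. -/
def L2.mk (f : ι → ℝ) (hf : Summable fun i => f i ^ 2) : L2 ι := ⟨f, memℓp_two_iff.2 hf⟩

@[simp] theorem L2.mk_apply (f : ι → ℝ) (hf : Summable fun i => f i ^ 2) (i : ι) :
    L2.mk f hf i = f i := rfl

theorem L2.hasSum_inner (f g : L2 ι) : HasSum (fun i => f i * g i) ⟪f, g⟫_ℝ := by
  simpa [mul_comm] using lp.hasSum_inner (𝕜 := ℝ) f g

theorem L2.hasSum_norm_sq (f : L2 ι) : HasSum (fun i => f i ^ 2) (‖f‖ ^ 2) := by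
  simpa [sq, real_inner_self_eq_norm_sq] using L2.hasSum_inner f f

theorem L2.summable_sq (f : L2 ι) : Summable fun i => f i ^ 2 := (L2.hasSum_norm_sq f).summable

theorem L2.abs_apply_le (f : L2 ι) (i : ι) : |f i| ≤ ‖f‖ :=
  lp.norm_apply_le_norm (by norm_num) f i

theorem L2.continuous_apply (i : ι) : Continuous fun f : L2 ι => f i :=
  (lp.evalCLM ℝ (fun _ : ι => ℝ) 2 i).continuous

theorem L2.norm_sq_eq (f : L2 ι) : ‖f‖ ^ 2 = ∑' i, f i ^ 2 := (L2.hasSum_norm_sq f).tsum_eq.symm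

theorem L2.norm_le_of_sq_le {f : L2 ι} {C : ℝ} (hC : 0 ≤ C) (h : ‖f‖ ^ 2 ≤ C ^ 2) : ‖f‖ ≤ C :=
  abs_le_of_sq_le_sq' h hC |>.2

theorem L2.ext {f g : L2 ι} (h : ∀ i, f i = g i) : f = g := lp.ext (funext h)

/-- Dominated convergence in `L2 ι`. -/
theorem L2.tendsto_of_dominated {f : ℕ → L2 ι} {g : L2 ι} {b : ι → ℝ}
    (hb : Summable fun i => b i ^ 2) (hfb : ∀ k i, |f k i - g i| ≤ b i)
    (hf : ∀ i, Tendsto (fun k => f k i) atTop (𝓝 (g i))) : Tendsto f atTop (𝓝 g) := by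
  rw [tendsto_iff_norm_sub_tendsto_zero]
  have h : Tendsto (fun k => ‖f k - g‖ ^ 2) atTop (𝓝 0) := by
    simp only [L2.norm_sq_eq]
    have := tendsto_tsum_of_dominated_convergence (𝓕 := atTop)
      (f := fun k i => (f k - g) i ^ 2) (g := fun _ => (0 : ℝ)) hb ?_ ?_
    · simpa using this
    · intro i
      have := ((hf i).sub_const (g i)).pow 2
      simpa using this
    · refine Eventually.of_forall fun k i => ?_
      rw [Real.norm_of_nonneg (sq_nonneg _)]
      exact sq_le_sq.2 ((hfb k i).trans (le_abs_self _))
  have := h.sqrt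
  simpa using this

theorem HasSum.of_eq {f g : ι → ℝ} {S : ℝ} (hg : HasSum g S) (h : ∀ i, f i = g i) :
    HasSum f S := by
  rwa [funext h]

theorem tsum_ofReal_lt_top_iff {f : ι → ℝ} (hf : ∀ i, 0 ≤ f i) :
    ∑' i, ENNReal.ofReal (f i) < ∞ ↔ Summable f := by
  refine ⟨fun h => ?_, fun h => h.tsum_ofReal_lt_top⟩
  have := ENNReal.summable_toReal h.ne
  simpa [ENNReal.toReal_ofReal, hf] using this

variable {κ : Type*}

/-- Multiplication of a square summable family on `κ` by a square summable (hence bounded) family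
on `ι`, weighted by a bounded function and transported along a map `κ → ι`. -/
noncomputable def L2.mulLeft (c : ι → ℝ) {C : ℝ} (hc : ∀ i, |c i| ≤ C) (r : κ → ι) :
    L2 ι →L[ℝ] L2 κ →L[ℝ] L2 κ :=
  have hb : ∀ (ψ : L2 ι) (a : L2 κ) (k : κ),
      (c (r k) * ψ (r k) * a k) ^ 2 ≤ (C * ‖ψ‖) ^ 2 * a k ^ 2 := fun ψ a k => by
    rw [mul_pow]
    gcongr ?_ * _
    rw [← sq_abs, abs_mul]
    have h0 := (abs_nonneg _).trans (hc (r k))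
    gcongr
    · exact hc _
    · exact L2.abs_apply_le ψ _
  have hs : ∀ (ψ : L2 ι) (a : L2 κ), Summable fun k => (c (r k) * ψ (r k) * a k) ^ 2 :=
    fun ψ a => Summable.of_nonneg_of_le (fun _ => sq_nonneg _) (hb ψ a)
      ((L2.summable_sq a).mul_left _)
  LinearMap.mkContinuous₂
    (LinearMap.mk₂ ℝ (fun ψ a => L2.mk (fun k => c (r k) * ψ (r k) * a k) (hs ψ a))
      (fun _ _ _ => L2.ext fun k => by simp; ring) (fun _ _ _ => L2.ext fun k => by simp; ring)
      (fun _ _ _ => L2.ext fun k => by simp; ring) (fun _ _ _ => L2.ext fun k => by simp; ring))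
    |C| (fun ψ a => by
      refine L2.norm_le_of_sq_le (by positivity) ?_
      rw [LinearMap.mk₂_apply, L2.norm_sq_eq]
      refine ((hs ψ a).tsum_le_tsum (hb ψ a) ((L2.summable_sq a).mul_left _)).trans ?_
      rw [tsum_mul_left, ← L2.norm_sq_eq, mul_pow, mul_pow, mul_pow, sq_abs])

@[simp] theorem L2.mulLeft_apply (c : ι → ℝ) {C : ℝ} (hc : ∀ i, |c i| ≤ C) (r : κ → ι)
    (ψ : L2 ι) (a : L2 κ) (k : κ) : L2.mulLeft c hc r ψ a k = c (r k) * ψ (r k) * a k := rfl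

end SquareSummable

namespace WeightedGraph

variable {V : Type*} (G : WeightedGraph V)

/-! ### Pointwise calculus of Γ and normalised cutoffs -/

section Pointwise

theorem Gam_eq (f g : V → ℝ) (x : V) :
    G.Gam f g x = (G.m x)⁻¹ *
      ∑ y ∈ (G.locallyFinite x).toFinset, G.μ x y / 2 * ((f y - f x) * (g y - g x)) := by
  simp only [Gam, lap, mul_left_comm _ (G.m x)⁻¹, ← mul_sub, Finset.mul_sum,
    ← Finset.sum_sub_distrib]
  refine Finset.sum_congr rfl fun y _ => ?_
  ring

theorem m_mul_Gam (f g : V → ℝ) (x : V) :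
    G.m x * G.Gam f g x =
      ∑ y ∈ (G.locallyFinite x).toFinset, G.μ x y / 2 * ((f y - f x) * (g y - g x)) := by
  rw [Gam_eq, ← mul_assoc, mul_inv_cancel₀ (G.m_pos x).ne', one_mul]

theorem m_mul_lap (f : V → ℝ) (x : V) :
    G.m x * G.lap f x = ∑ y ∈ (G.locallyFinite x).toFinset, G.μ x y * (f y - f x) := by
  rw [lap, ← mul_assoc, mul_inv_cancel₀ (G.m_pos x).ne', one_mul]

theorem Gam_self_nonneg (f : V → ℝ) (x : V) : 0 ≤ G.Gam f f x := by
  rw [Gam_eq]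
  exact mul_nonneg (inv_nonneg.2 (G.m_pos x).le) (Finset.sum_nonneg fun y _ =>
    mul_nonneg (div_nonneg (G.μ_nonneg x y) two_pos.le) (mul_self_nonneg _))

theorem Gam_self_mono {f g : V → ℝ} (h : ∀ x y, |f y - f x| ≤ |g y - g x|) (x : V) :
    G.Gam f f x ≤ G.Gam g g x := by
  rw [Gam_eq, Gam_eq]
  refine mul_le_mul_of_nonneg_left (Finset.sum_le_sum fun y _ => ?_) (inv_nonneg.2 (G.m_pos x).le)
  refine mul_le_mul_of_nonneg_left ?_ (div_nonneg (G.μ_nonneg x y) two_pos.le)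
  rw [← abs_mul_abs_self (f y - f x), ← abs_mul_abs_self (g y - g x)]
  exact mul_self_le_mul_self (abs_nonneg _) (h x y)

/-- A cutoff sequence with values in the unit interval. -/
theorem Complete.exists_cutoff {G : WeightedGraph V} (hG : G.Complete) :
    ∃ η : ℕ → V → ℝ, (∀ k x, 0 ≤ η k x) ∧ (∀ k x, η k x ≤ 1) ∧
      (∀ k, (Function.support (η k)).Finite) ∧ (∀ x, Tendsto (fun k => η k x) atTop (𝓝 1)) ∧
      ∀ k x, G.Gam (η k) (η k) x ≤ 1 / ((k : ℝ) + 1) := by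
  obtain ⟨η, hmono, hfin, hlim, hΓ⟩ := hG
  -- Monotone convergence to 1 already bounds the cutoffs by 1. The positive part secures the lower
  -- bound and, being 1-Lipschitz, does not increase Γ.
  refine ⟨fun k x => max (η k x) 0, fun k x => le_max_right _ _, fun k x => max_le ?_ zero_le_one,
    fun k => (hfin k).subset fun x hx h => hx (by simp [h]), fun x => ?_, fun k x => ?_⟩
  · exact Monotone.ge_of_tendsto (fun i j hij => hmono hij x) (hlim x) k
  · simpa using (hlim x).max (tendsto_const_nhds (x := (0 : ℝ)))
  · exact (G.Gam_self_mono (fun x y => abs_max_sub_max_le_abs _ _ _) x).trans (hΓ k x)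

end Pointwise

/-! ### Sums over ordered pairs of vertices, and Green's formula -/

section EdgeSums

theorem finite_incident {S : Set V} (hS : S.Finite) :
    {p : V × V | G.Adj p.1 p.2 ∧ (p.1 ∈ S ∨ p.2 ∈ S)}.Finite := by
  have h1 : (⋃ x ∈ S, (fun y => (x, y)) '' {y | G.Adj x y}).Finite :=
    hS.biUnion fun x _ => (G.locallyFinite x).image _
  refine (h1.union (h1.image Prod.swap)).subset ?_
  rintro ⟨x, y⟩ ⟨hxy, hx | hy⟩
  · exact Or.inl (Set.mem_biUnion hx ⟨y, hxy, rfl⟩)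
  · exact Or.inr ⟨(y, x), Set.mem_biUnion hy ⟨x, G.adj_symm _ _ hxy, rfl⟩, rfl⟩

theorem summable_of_incident {S : Set V} (hS : S.Finite) {F : V × V → ℝ}
    (hF : ∀ p, ¬ G.Adj p.1 p.2 → F p = 0) (hF' : ∀ p, p.1 ∉ S → p.2 ∉ S → F p = 0) :
    Summable F := by
  refine summable_of_hasFiniteSupport ((G.finite_incident hS).subset fun p hp => ?_)
  by_contra h
  rw [Set.mem_ofPred_eq, not_and_or, not_or] at h
  rcases h with h | h
  · exact hp (hF p h)
  · exact hp (hF' p h.1 h.2)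

theorem hasSum_fiber {F : V × V → ℝ} (hF : ∀ p, ¬ G.Adj p.1 p.2 → F p = 0) (x : V) :
    HasSum (fun y => F (x, y)) (∑ y ∈ (G.locallyFinite x).toFinset, F (x, y)) :=
  hasSum_sum_of_ne_finset_zero fun y hy => hF _ (by simpa using hy)

theorem hasSum_vertex {F : V × V → ℝ} (hF : ∀ p, ¬ G.Adj p.1 p.2 → F p = 0) {S : ℝ}
    (h : HasSum F S) : HasSum (fun x => ∑ y ∈ (G.locallyFinite x).toFinset, F (x, y)) S :=
  h.prod_fiberwise (G.hasSum_fiber hF)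

theorem hasSum_edge {F : V × V → ℝ} (hF : ∀ p, ¬ G.Adj p.1 p.2 → F p = 0) (hF0 : ∀ p, 0 ≤ F p)
    {S : ℝ} (h : HasSum (fun x => ∑ y ∈ (G.locallyFinite x).toFinset, F (x, y)) S) :
    HasSum F S := by
  have hs : Summable F := by
    rw [summable_prod_of_nonneg hF0]
    refine ⟨fun x => (G.hasSum_fiber hF x).summable, ?_⟩
    simpa only [(G.hasSum_fiber hF _).tsum_eq] using h.summable
  have := G.hasSum_vertex hF hs.hasSum
  rw [h.unique this]
  exact hs.hasSum

theorem hasSum_swap {F : V × V → ℝ} {S : ℝ} (h : HasSum F S) :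
    HasSum (fun p : V × V => F (p.2, p.1)) S :=
  (Equiv.prodComm V V).hasSum_iff.2 h

/-- Green's formula, for a finitely supported test function or a finitely supported potential. -/
theorem green {u φ : V → ℝ}
    (h : (Function.support φ).Finite ∨ (Function.support u).Finite) :
    ∃ S, HasSum (fun x => G.m x * φ x * G.lap u x) S ∧
      HasSum (fun p : V × V => G.μ p.1 p.2 / 2 * ((u p.2 - u p.1) * (φ p.2 - φ p.1))) (-S) := by
  set F : V × V → ℝ := fun p => G.μ p.1 p.2 * φ p.1 * (u p.2 - u p.1) with hF
  have hF0 : ∀ p, ¬ G.Adj p.1 p.2 → F p = 0 := fun p hp => by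
    simp [hF, G.μ_eq_zero _ _ hp]
  have hs : Summable F := by
    rcases h with h | h
    · refine G.summable_of_incident h hF0 fun p h1 _ => ?_
      simp [hF, Function.notMem_support.1 h1]
    · refine G.summable_of_incident h hF0 fun p h1 h2 => ?_
      simp [hF, Function.notMem_support.1 h1, Function.notMem_support.1 h2]
  refine ⟨∑' p, F p, ?_, ?_⟩
  · convert G.hasSum_vertex hF0 hs.hasSum using 2 with x
    rw [mul_right_comm, m_mul_lap, Finset.sum_mul]
    refine Finset.sum_congr rfl fun y _ => ?_
    simp only [hF]
    ring
  · have h2 := (hs.hasSum.add (hasSum_swap hs.hasSum)).mul_left (-(1 / 2))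
    have e : -(1 / 2) * (∑' p, F p + ∑' p, F p) = -∑' p, F p := by ring
    rw [e] at h2
    refine h2.of_eq fun p => ?_
    simp only [hF, G.μ_symm p.2 p.1]
    ring

end EdgeSums

end WeightedGraph

namespace WeightedGraph

variable {V : Type*} (G : WeightedGraph V)

/-! ### Orthonormal coordinates for the weighted ℓ² space -/

section Coordinates

/-- The function on `V` with coordinates `h` in the orthonormal basis `1_x / √m(x)`. -/
noncomputable def fn (h : L2 V) (x : V) : ℝ := h x / √(G.m x)

theorem sqrt_m_pos (x : V) : 0 < √(G.m x) := Real.sqrt_pos.2 (G.m_pos x)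

theorem sqrt_m_mul_fn (h : L2 V) (x : V) : √(G.m x) * G.fn h x = h x :=
  mul_div_cancel₀ _ (G.sqrt_m_pos x).ne'

theorem m_mul_fn_mul_fn (h k : L2 V) (x : V) : G.m x * G.fn h x * G.fn k x = h x * k x := by
  rw [← G.sqrt_m_mul_fn h, ← G.sqrt_m_mul_fn k]
  nth_rewrite 1 [← Real.mul_self_sqrt (G.m_pos x).le]
  ring

@[simp] theorem fn_add (h k : L2 V) (x : V) : G.fn (h + k) x = G.fn h x + G.fn k x := add_div _ _ _

@[simp] theorem fn_sub (h k : L2 V) (x : V) : G.fn (h - k) x = G.fn h x - G.fn k x := sub_div _ _ _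

@[simp] theorem fn_smul (c : ℝ) (h : L2 V) (x : V) : G.fn (c • h) x = c * G.fn h x :=
  mul_div_assoc _ _ _

@[simp] theorem fn_zero (x : V) : G.fn 0 x = 0 := zero_div _

theorem fn_injective : Function.Injective G.fn := fun h k hk => L2.ext fun x => by
  rw [← G.sqrt_m_mul_fn h, ← G.sqrt_m_mul_fn k, hk]

theorem continuous_fn (x : V) : Continuous fun h => G.fn h x :=
  (L2.continuous_apply x).div_const _

/-- The coordinates of a square summable function. -/
noncomputable def coord (u : V → ℝ) (hu : Summable fun x => G.m x * u x ^ 2) : L2 V :=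
  L2.mk (fun x => √(G.m x) * u x) (by simpa [mul_pow, Real.sq_sqrt (G.m_pos _).le] using hu)

@[simp] theorem fn_coord (u : V → ℝ) (hu : Summable fun x => G.m x * u x ^ 2) :
    G.fn (G.coord u hu) = u :=
  funext fun x => mul_div_cancel_left₀ _ (G.sqrt_m_pos x).ne'

theorem hasSum_inner_fn (h k : L2 V) :
    HasSum (fun x => G.m x * G.fn h x * G.fn k x) ⟪h, k⟫_ℝ := by
  simpa only [m_mul_fn_mul_fn] using L2.hasSum_inner h k

theorem hasSum_norm_sq_fn (h : L2 V) : HasSum (fun x => G.m x * G.fn h x ^ 2) (‖h‖ ^ 2) := by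
  simpa [sq, mul_assoc, real_inner_self_eq_norm_sq] using G.hasSum_inner_fn h h

theorem inner2_fn (h k : L2 V) : G.inner2 (G.fn h) (G.fn k) = ⟪h, k⟫_ℝ :=
  (G.hasSum_inner_fn h k).tsum_eq

theorem normSq_nonneg_term (u : V → ℝ) (x : V) : 0 ≤ G.m x * u x ^ 2 :=
  mul_nonneg (G.m_pos x).le (sq_nonneg _)

theorem normSq_fn (h : L2 V) : G.normSq (G.fn h) = ENNReal.ofReal (‖h‖ ^ 2) := by
  rw [normSq, ← ENNReal.ofReal_tsum_of_nonneg (G.normSq_nonneg_term _)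
    (G.hasSum_norm_sq_fn h).summable, (G.hasSum_norm_sq_fn h).tsum_eq]

theorem mem_ell2_iff_summable {u : V → ℝ} :
    u ∈ G.ell2 ↔ Summable fun x => G.m x * u x ^ 2 :=
  tsum_ofReal_lt_top_iff (G.normSq_nonneg_term u)

theorem mem_ell2_iff {u : V → ℝ} : u ∈ G.ell2 ↔ ∃ h, G.fn h = u := by
  rw [mem_ell2_iff_summable]
  refine ⟨fun hu => ⟨_, G.fn_coord u hu⟩, ?_⟩
  rintro ⟨h, rfl⟩
  exact (G.hasSum_norm_sq_fn h).summable

theorem exists_fn_eq_of_finite {u : V → ℝ} (hu : (Function.support u).Finite) :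
    ∃ h, G.fn h = u :=
  ⟨_, G.fn_coord u (summable_of_hasFiniteSupport (hu.subset fun x hx h => hx (by simp [h])))⟩

/-- Summable functions are square summable when the vertex measure is nondegenerate. -/
theorem Nondegenerate.exists_fn_eq {G : WeightedGraph V} (hG : G.Nondegenerate) {u : V → ℝ}
    (hu : Summable fun x => G.m x * |u x|) : ∃ h, G.fn h = u := by
  obtain ⟨δ, hδ, hm⟩ := hG
  refine ⟨_, G.fn_coord u (Summable.of_nonneg_of_le (G.normSq_nonneg_term u) (fun x => ?_)
    (hu.mul_left (δ⁻¹ * ∑' x, G.m x * |u x|)))⟩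
  have h1 : G.m x * |u x| ≤ ∑' x, G.m x * |u x| :=
    hu.le_tsum x fun y _ => mul_nonneg (G.m_pos y).le (abs_nonneg _)
  have h2 : |u x| ≤ δ⁻¹ * ∑' x, G.m x * |u x| := by
    rw [inv_mul_eq_div, le_div_iff₀ hδ]
    nlinarith [hm x, abs_nonneg (u x)]
  have h3 := mul_nonneg (G.m_pos x).le (abs_nonneg (u x))
  rw [← sq_abs]
  nlinarith

end Coordinates

/-! ### Gradients as square summable families, and the form domain -/

section Gradient

/-- `a` is the gradient of the function with coordinates `h`. -/
def IsGrad (h : L2 V) (a : L2 (V × V)) : Prop :=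
  ∀ p, a p = √(G.μ p.1 p.2 / 2) * (G.fn h p.2 - G.fn h p.1)

variable {G}

theorem IsGrad.add {h k : L2 V} {a b : L2 (V × V)} (ha : G.IsGrad h a) (hb : G.IsGrad k b) :
    G.IsGrad (h + k) (a + b) := fun p => by
  simp only [lp.coeFn_add, Pi.add_apply, ha p, hb p, fn_add]; ring

theorem IsGrad.smul {h : L2 V} {a : L2 (V × V)} (c : ℝ) (ha : G.IsGrad h a) :
    G.IsGrad (c • h) (c • a) := fun p => by
  simp only [lp.coeFn_smul, Pi.smul_apply, smul_eq_mul, ha p, fn_smul]; ring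

theorem IsGrad.sub {h k : L2 V} {a b : L2 (V × V)} (ha : G.IsGrad h a) (hb : G.IsGrad k b) :
    G.IsGrad (h - k) (a - b) := fun p => by
  simp only [lp.coeFn_sub, Pi.sub_apply, ha p, hb p, fn_sub]; ring

theorem IsGrad.unique {h : L2 V} {a b : L2 (V × V)} (ha : G.IsGrad h a) (hb : G.IsGrad h b) :
    a = b := L2.ext fun p => (ha p).trans (hb p).symm

theorem isGrad_zero : G.IsGrad 0 0 := fun p => by simp

theorem IsGrad.of_tendsto {ι : Type*} {l : Filter ι} [l.NeBot] {h : ι → L2 V}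
    {a : ι → L2 (V × V)} {h₀ : L2 V} {a₀ : L2 (V × V)} (H : ∀ᶠ i in l, G.IsGrad (h i) (a i))
    (hh : Tendsto h l (𝓝 h₀)) (ha : Tendsto a l (𝓝 a₀)) : G.IsGrad h₀ a₀ := fun p => by
  refine tendsto_nhds_unique (((L2.continuous_apply p).tendsto _).comp ha) ?_
  refine Tendsto.congr' ?_ (((((G.continuous_fn p.2).tendsto _).comp hh).sub
    (((G.continuous_fn p.1).tendsto _).comp hh)).const_mul _)
  filter_upwards [H] with i hi using (hi p).symm

theorem IsGrad.mul_eq {h k : L2 V} {a b : L2 (V × V)} (ha : G.IsGrad h a) (hb : G.IsGrad k b)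
    (p : V × V) : a p * b p =
      G.μ p.1 p.2 / 2 * ((G.fn h p.2 - G.fn h p.1) * (G.fn k p.2 - G.fn k p.1)) := by
  rw [ha p, hb p]
  nth_rewrite 3 [← Real.mul_self_sqrt (div_nonneg (G.μ_nonneg p.1 p.2) two_pos.le)]
  ring

theorem IsGrad.hasSum_inner {h k : L2 V} {a b : L2 (V × V)} (ha : G.IsGrad h a)
    (hb : G.IsGrad k b) : HasSum (fun p : V × V =>
      G.μ p.1 p.2 / 2 * ((G.fn h p.2 - G.fn h p.1) * (G.fn k p.2 - G.fn k p.1))) ⟪a, b⟫_ℝ := by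
  simpa only [ha.mul_eq hb] using L2.hasSum_inner a b

/-- The weight √(μ/2) in the gradient absorbs the factor 1/2 that compensates for counting ordered
pairs. -/
theorem IsGrad.form_eq {h k : L2 V} {a b : L2 (V × V)} (ha : G.IsGrad h a) (hb : G.IsGrad k b) :
    G.form (G.fn h) (G.fn k) = ⟪a, b⟫_ℝ := by
  rw [form, ← (ha.hasSum_inner hb).tsum_eq, ← tsum_mul_left]
  exact tsum_congr fun p => by ring

variable (G) in
theorem energy_eq (u : V → ℝ) : G.energy u =
    ∑' p : V × V, ENNReal.ofReal (G.μ p.1 p.2 / 2 * ((u p.2 - u p.1) * (u p.2 - u p.1))) := by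
  rw [energy, ← ENNReal.tsum_mul_left]
  refine tsum_congr fun p => ?_
  have : (1 / 2 : ℝ≥0∞) = ENNReal.ofReal (1 / 2) := by
    rw [ENNReal.ofReal_div_of_pos two_pos]; simp
  rw [this, ← ENNReal.ofReal_mul (by norm_num)]
  congr 1
  ring

variable (G) in
theorem energy_term_nonneg (u : V → ℝ) (p : V × V) :
    0 ≤ G.μ p.1 p.2 / 2 * ((u p.2 - u p.1) * (u p.2 - u p.1)) :=
  mul_nonneg (div_nonneg (G.μ_nonneg _ _) two_pos.le) (mul_self_nonneg _)

theorem IsGrad.energy_eq {h : L2 V} {a : L2 (V × V)} (ha : G.IsGrad h a) :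
    G.energy (G.fn h) = ENNReal.ofReal (‖a‖ ^ 2) := by
  have := ha.hasSum_inner ha
  rw [WeightedGraph.energy_eq, ← ENNReal.ofReal_tsum_of_nonneg (G.energy_term_nonneg _)
    this.summable, this.tsum_eq, real_inner_self_eq_norm_sq]

theorem exists_isGrad_of_summable {h : L2 V} (hs : Summable fun p : V × V =>
    G.μ p.1 p.2 / 2 * ((G.fn h p.2 - G.fn h p.1) * (G.fn h p.2 - G.fn h p.1))) :
    ∃ a, G.IsGrad h a := by
  refine ⟨L2.mk (fun p => √(G.μ p.1 p.2 / 2) * (G.fn h p.2 - G.fn h p.1)) ?_, fun p => rfl⟩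
  refine hs.congr fun p => ?_
  rw [mul_pow, Real.sq_sqrt (div_nonneg (G.μ_nonneg p.1 p.2) two_pos.le), sq]

theorem exists_isGrad_of_energy {h : L2 V} (hs : G.energy (G.fn h) < ∞) : ∃ a, G.IsGrad h a := by
  rw [WeightedGraph.energy_eq, tsum_ofReal_lt_top_iff (G.energy_term_nonneg _)] at hs
  exact exists_isGrad_of_summable hs

theorem exists_isGrad_of_finite {h : L2 V} (hh : (Function.support (G.fn h)).Finite) :
    ∃ a, G.IsGrad h a := by
  refine exists_isGrad_of_summable (G.summable_of_incident hh (fun p hp => ?_) fun p h1 h2 => ?_)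
  · simp [G.μ_eq_zero _ _ hp]
  · simp [Function.notMem_support.1 h1, Function.notMem_support.1 h2]

/-- Summation of `ψ Γ(u, v)` over the vertices as a sum over the edges. -/
theorem IsGrad.hasSum_Gam {h k : L2 V} {a b : L2 (V × V)} (ha : G.IsGrad h a)
    (hb : G.IsGrad k b) {ψ : V → ℝ} {S : ℝ} (hS : HasSum (fun p : V × V => ψ p.1 * a p * b p) S) :
    HasSum (fun x => G.m x * ψ x * G.Gam (G.fn h) (G.fn k) x) S := by
  have h0 : ∀ p : V × V, ¬ G.Adj p.1 p.2 → ψ p.1 * a p * b p = 0 := fun p hp => by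
    rw [ha p, G.μ_eq_zero _ _ hp]; simp
  convert G.hasSum_vertex h0 hS using 2 with x
  rw [mul_right_comm, m_mul_Gam, Finset.sum_mul]
  refine Finset.sum_congr rfl fun y _ => ?_
  have := ha.mul_eq hb (x, y)
  linear_combination -ψ x * this

/-- A function in `ℓ²` of finite energy is approximated by finitely supported functions. -/
theorem IsGrad.exists_approx (hG : G.Complete) {h : L2 V} {a : L2 (V × V)} (ha : G.IsGrad h a) :
    ∃ (g : ℕ → L2 V) (b : ℕ → L2 (V × V)), (∀ k, (Function.support (G.fn (g k))).Finite) ∧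
      (∀ k, G.IsGrad (g k) (b k)) ∧ Tendsto g atTop (𝓝 h) ∧ Tendsto b atTop (𝓝 a) ∧
      ∀ k x, 0 ≤ G.fn h x → 0 ≤ G.fn (g k) x := by
  obtain ⟨η, h0, h1, hfin, hlim, hΓ⟩ := hG.exists_cutoff
  have habs : ∀ k x, |η k x - 1| ≤ 1 := fun k x => by
    rw [abs_le]; constructor <;> linarith [h0 k x, h1 k x]
  have habs' : ∀ k x, |η k x| ≤ 1 := fun k x => by
    rw [abs_le]; constructor <;> linarith [h0 k x, h1 k x]
  have hle : ∀ k x, (η k x * h x) ^ 2 ≤ h x ^ 2 := fun k x => by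
    rw [mul_pow]
    exact mul_le_of_le_one_left (sq_nonneg _) ((sq_le_one_iff_abs_le_one _).2 (habs' k x))
  set g : ℕ → L2 V := fun k => L2.mk (fun x => η k x * h x)
    (Summable.of_nonneg_of_le (fun _ => sq_nonneg _) (hle k) (L2.summable_sq h)) with hg
  have hfn : ∀ k x, G.fn (g k) x = η k x * G.fn h x := fun k x => mul_div_assoc _ _ _
  have hsupp : ∀ k, (Function.support (G.fn (g k))).Finite := fun k =>
    (hfin k).subset fun x hx h' => hx (by rw [hfn, h', zero_mul])
  choose b hb using fun k => exists_isGrad_of_finite (hsupp k)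
  have hb1 : ∀ k p, ((η k p.2 - 1) * a p) ^ 2 ≤ a p ^ 2 := fun k p => by
    rw [mul_pow]
    exact mul_le_of_le_one_left (sq_nonneg _) ((sq_le_one_iff_abs_le_one _).2 (habs k p.2))
  -- By the Leibniz rule ∇(ηu) - ∇u splits into (η - 1)∇u, with η read at the terminal vertex, and
  -- u∇η, with u read at the initial vertex. The first part vanishes by dominated convergence.
  set b1 : ℕ → L2 (V × V) := fun k => L2.mk (fun p => (η k p.2 - 1) * a p)
    (Summable.of_nonneg_of_le (fun _ => sq_nonneg _) (hb1 k) (L2.summable_sq a)) with hb1d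
  have hb1lim : Tendsto b1 atTop (𝓝 0) := by
    refine L2.tendsto_of_dominated (b := fun p => |a p|) ?_ (fun k p => ?_) fun p => ?_
    · simpa using L2.summable_sq a
    · simpa [hb1d] using sq_le_sq.1 (hb1 k p)
    · simpa [hb1d] using ((hlim p.2).sub_const 1).mul_const (a p)
  have hdiff : ∀ k p, (b k - a - b1 k) p =
      √(G.μ p.1 p.2 / 2) * (G.fn h p.1 * (η k p.2 - η k p.1)) := fun k p => by
    simp only [lp.coeFn_sub, Pi.sub_apply, hb k p, ha p, hb1d, L2.mk_apply, hfn]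
    ring
  -- For the part u∇η, summing over the terminal vertex first produces m u² Γ(η_k), which
  -- completeness makes small.
  have hdn : ∀ k, ‖b k - a - b1 k‖ ^ 2 ≤ ‖h‖ ^ 2 * (1 / ((k : ℝ) + 1)) := fun k => by
    have e : ∀ p : V × V, (b k - a - b1 k) p ^ 2 =
        G.μ p.1 p.2 / 2 * (G.fn h p.1 ^ 2 * (η k p.2 - η k p.1) ^ 2) := fun p => by
      rw [hdiff, mul_pow, Real.sq_sqrt (div_nonneg (G.μ_nonneg _ _) two_pos.le), mul_pow]
    have h2 := G.hasSum_vertex (F := fun p => (b k - a - b1 k) p ^ 2)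
      (fun p hp => by rw [e, G.μ_eq_zero _ _ hp]; simp) (L2.hasSum_norm_sq (b k - a - b1 k))
    refine hasSum_le (fun x => ?_) h2 ((G.hasSum_norm_sq_fn h).mul_right _)
    calc _ = G.m x * G.Gam (η k) (η k) x * G.fn h x ^ 2 := by
          rw [m_mul_Gam, Finset.sum_mul]
          refine Finset.sum_congr rfl fun y _ => ?_
          rw [e]; ring
      _ ≤ G.m x * (1 / ((k : ℝ) + 1)) * G.fn h x ^ 2 := by
          have := (G.m_pos x).le
          gcongr
          exact hΓ k x
      _ = _ := by ring
  have hdlim : Tendsto (fun k => b k - a - b1 k) atTop (𝓝 0) := by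
    rw [tendsto_zero_iff_norm_tendsto_zero]
    have h3 : Tendsto (fun k : ℕ => ‖h‖ ^ 2 * (1 / ((k : ℝ) + 1))) atTop (𝓝 (‖h‖ ^ 2 * 0)) :=
      tendsto_one_div_add_atTop_nhds_zero_nat.const_mul _
    rw [mul_zero] at h3
    have h4 := (squeeze_zero (fun k => sq_nonneg _) hdn h3).sqrt
    simpa using h4
  refine ⟨g, b, hsupp, hb, ?_, ?_, fun k x hx => ?_⟩
  · refine L2.tendsto_of_dominated (b := fun x => |h x|) ?_ (fun k x => ?_) fun x => ?_
    · simpa using L2.summable_sq h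
    · have : g k x - h x = (η k x - 1) * h x := by simp [hg]; ring
      rw [this, abs_mul]
      exact mul_le_of_le_one_left (abs_nonneg _) (habs k x)
    · simpa [hg] using (hlim x).mul_const (h x)
  · have := (hdlim.add hb1lim).add_const a
    simpa using this
  · rw [hfn]
    exact mul_nonneg (h0 k x) hx

/-- On a complete graph the form domain consists of all `ℓ²` functions of finite energy. -/
theorem Complete.mem_domQ_iff (hG : G.Complete) {u : V → ℝ} :
    u ∈ G.domQ ↔ ∃ h a, G.IsGrad h a ∧ G.fn h = u := by
  constructor
  · rintro ⟨hu, h⟩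
    obtain ⟨h', rfl⟩ := G.mem_ell2_iff.1 hu
    -- One approximant at any finite distance suffices, since finitely supported functions have
    -- finite energy.
    obtain ⟨φ, hφ, hlt⟩ := h 1 one_pos
    obtain ⟨k, rfl⟩ := G.exists_fn_eq_of_finite hφ
    have e : G.fn h' - G.fn k = G.fn (h' - k) := by ext x; simp
    rw [e] at hlt
    obtain ⟨a, ha⟩ := exists_isGrad_of_energy
      ((le_add_self.trans_lt hlt).trans ENNReal.one_lt_top)
    obtain ⟨b, hb⟩ := exists_isGrad_of_finite hφ
    exact ⟨h', a + b, by simpa using ha.add hb, rfl⟩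
  · rintro ⟨h, a, ha, rfl⟩
    refine ⟨G.mem_ell2_iff.2 ⟨h, rfl⟩, fun ε hε => ?_⟩
    obtain ⟨g, b, hfin, hb, hg, hba, -⟩ := ha.exists_approx hG
    have h1 : Tendsto (fun k => ENNReal.ofReal (‖h - g k‖ ^ 2) + ENNReal.ofReal (‖a - b k‖ ^ 2))
        atTop (𝓝 0) := by
      have h2 := ENNReal.tendsto_ofReal ((hg.const_sub h).norm.pow 2)
      have h3 := ENNReal.tendsto_ofReal ((hba.const_sub a).norm.pow 2)
      simpa using h2.add h3
    obtain ⟨k, hk⟩ := (h1.eventually (gt_mem_nhds hε)).exists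
    refine ⟨G.fn (g k), hfin k, ?_⟩
    have e : G.fn h - G.fn (g k) = G.fn (h - g k) := by ext x; simp
    rw [e, normSq_fn, (ha.sub (hb k)).energy_eq]
    exact hk

end Gradient

end WeightedGraph

/-! ### The generator of the Dirichlet form -/

/-- The exponential of `t α (J - 1)` as a Poisson average of the powers of `J`. -/
theorem hasSum_expOp_apply {H : Type*} [NormedAddCommGroup H] [InnerProductSpace ℝ H]
    [CompleteSpace H] (J : H →L[ℝ] H) (α t : ℝ) (g : H) :
    HasSum (fun k : ℕ => (Real.exp (-(t * α)) * ((t * α) ^ k / (k.factorial : ℝ))) • (J ^ k) g)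
      (expOp (α • (J - 1)) t g) := by
  let _ : NormedAlgebra ℚ (H →L[ℝ] H) := NormedAlgebra.restrictScalars ℚ ℝ _
  have h1 : t • α • (J - 1) = algebraMap ℝ (H →L[ℝ] H) (-(t * α)) + (t * α) • J := by
    rw [Algebra.algebraMap_eq_smul_one, smul_smul, smul_sub, neg_smul]
    abel
  have h2 : expOp (α • (J - 1)) t = Real.exp (-(t * α)) • NormedSpace.exp ((t * α) • J) := by
    rw [expOp, h1, NormedSpace.exp_add_of_commute (Algebra.commutes _ _),
      ← NormedSpace.algebraMap_exp_comm, ← Real.exp_eq_exp_ℝ, ← Algebra.smul_def]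
  have h3 := (NormedSpace.exp_series_hasSum_exp' (𝕂 := ℝ) ((t * α) • J)).mapL
    (ContinuousLinearMap.apply ℝ H g)
  rw [h2]
  convert h3.const_smul (Real.exp (-(t * α))) using 2 with k
  · rw [ContinuousLinearMap.apply_apply, smul_pow, smul_smul, mul_smul, div_eq_inv_mul]
    rfl
  · rfl

namespace WeightedGraph

variable {V : Type*} (G : WeightedGraph V)

/-- The graph of the generator of the Dirichlet form, in coordinates. -/
def generator : Submodule ℝ (L2 V × L2 V) where
  carrier := {p | ∃ a, G.IsGrad p.1 a ∧ ∀ v b, G.IsGrad v b → ⟪p.2, v⟫_ℝ = -⟪a, b⟫_ℝ}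
  add_mem' := by
    rintro ⟨u, w⟩ ⟨u', w'⟩ ⟨a, ha, h⟩ ⟨a', ha', h'⟩
    refine ⟨a + a', ha.add ha', fun v b hb => ?_⟩
    simp only [Prod.mk_add_mk, inner_add_left] at h h' ⊢
    rw [h v b hb, h' v b hb]
    ring
  zero_mem' := ⟨0, isGrad_zero, fun v b _ => by simp⟩
  smul_mem' := by
    rintro c ⟨u, w⟩ ⟨a, ha, h⟩
    refine ⟨c • a, ha.smul c, fun v b hb => ?_⟩
    simp only [Prod.smul_mk, inner_smul_left, RCLike.conj_to_real] at h ⊢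
    rw [h v b hb]
    ring

variable {G}

theorem inner_eq_of_mem_generator {u w v : L2 V} {a b : L2 (V × V)} (h : (u, w) ∈ G.generator)
    (ha : G.IsGrad u a) (hb : G.IsGrad v b) : ⟪w, v⟫_ℝ = -⟪a, b⟫_ℝ := by
  obtain ⟨a', ha', h'⟩ := h
  rw [ha.unique ha', h' v b hb]

/-- `generator` tests against every function of finite energy, `IsGenerator` only against D(Q); on a
complete graph these test spaces coincide. -/
theorem Complete.isGenerator_fn_iff (hG : G.Complete) {u w : L2 V} :
    G.IsGenerator (G.fn u) (G.fn w) ↔ (u, w) ∈ G.generator := by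
  constructor
  · rintro ⟨hu, -, h⟩
    obtain ⟨u', a, ha, hu'⟩ := hG.mem_domQ_iff.1 hu
    obtain rfl := G.fn_injective hu'
    refine ⟨a, ha, fun v b hb => ?_⟩
    rw [← G.inner2_fn, h _ (hG.mem_domQ_iff.2 ⟨v, b, hb, rfl⟩), ha.form_eq hb]
  · rintro ⟨a, ha, h⟩
    refine ⟨hG.mem_domQ_iff.2 ⟨u, a, ha, rfl⟩, G.mem_ell2_iff.2 ⟨w, rfl⟩, fun v hv => ?_⟩
    obtain ⟨v, b, hb, rfl⟩ := hG.mem_domQ_iff.1 hv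
    rw [inner2_fn, ha.form_eq hb, h v b hb]

variable (G) in
theorem finite_support_lap {u : V → ℝ} (hu : (Function.support u).Finite) :
    (Function.support (G.lap u)).Finite := by
  refine ((G.finite_incident hu).image Prod.fst).subset fun x hx => ?_
  have h1 : ∑ y ∈ (G.locallyFinite x).toFinset, G.μ x y * (u y - u x) ≠ 0 := fun h =>
    hx (by rw [lap, h, mul_zero])
  obtain ⟨y, hy, hne⟩ := Finset.exists_ne_zero_of_sum_ne_zero h1
  refine ⟨(x, y), ⟨by simpa using hy, ?_⟩, rfl⟩
  by_contra! h
  apply hne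
  simp [Function.notMem_support.1 h.1, Function.notMem_support.1 h.2]

/-- The generator acts on finitely supported functions as the Laplacian. -/
theorem mem_generator_of_finite {u w : L2 V} (hu : (Function.support (G.fn u)).Finite)
    (hw : G.fn w = G.lap (G.fn u)) : (u, w) ∈ G.generator := by
  obtain ⟨a, ha⟩ := exists_isGrad_of_finite hu
  refine ⟨a, ha, fun v b hb => ?_⟩
  obtain ⟨S, h1, h2⟩ := G.green (u := G.fn u) (φ := G.fn v) (Or.inr hu)
  rw [← (ha.hasSum_inner hb).unique h2 |>.symm, neg_neg]
  refine (G.hasSum_inner_fn w v).unique ?_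
  simpa only [hw, mul_right_comm] using h1

theorem exists_mem_generator_of_finite {u : L2 V} (hu : (Function.support (G.fn u)).Finite) :
    ∃ w, (u, w) ∈ G.generator ∧ G.fn w = G.lap (G.fn u) ∧ (Function.support (G.fn w)).Finite := by
  have h := G.finite_support_lap hu
  obtain ⟨w, hw⟩ := G.exists_fn_eq_of_finite h
  exact ⟨w, mem_generator_of_finite hu hw, hw, hw ▸ h⟩

/-- The generator acts as the Laplacian. -/
theorem fn_eq_lap_of_mem_generator {u w : L2 V} (h : (u, w) ∈ G.generator) :
    G.fn w = G.lap (G.fn u) := by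
  classical
  funext x
  have hφ : (Function.support (Pi.single x (1 : ℝ) : V → ℝ)).Finite :=
    (Set.finite_singleton x).subset (Pi.support_single_subset)
  obtain ⟨v, hv⟩ := G.exists_fn_eq_of_finite hφ
  obtain ⟨b, hb⟩ := exists_isGrad_of_finite (hv.symm ▸ hφ : (Function.support (G.fn v)).Finite)
  obtain ⟨a, ha, h'⟩ := h
  obtain ⟨S, h1, h2⟩ := G.green (u := G.fn u) (φ := G.fn v) (Or.inl (hv.symm ▸ hφ))
  have h3 : ⟪w, v⟫_ℝ = S := by
    rw [h' v b hb, (ha.hasSum_inner hb).unique h2, neg_neg]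
  have h4 := G.hasSum_inner_fn w v
  rw [h3] at h4
  have h5 := h4.unique (hasSum_single x fun y hy => by rw [hv]; simp [hy])
  have h6 := h1.unique (hasSum_single x fun y hy => by rw [hv]; simp [hy])
  rw [h5, hv] at h6
  simpa [(G.m_pos x).ne'] using h6

-- The partial sums of the coordinate expansion are finitely supported, hence in the domain.
variable (G) in
theorem dense_domain_generator : Dense {u | ∃ w, (u, w) ∈ G.generator} := by
  classical
  intro h
  have h1 := lp.hasSum_single (E := fun _ : V => ℝ) (p := 2) (by norm_num) h
  refine mem_closure_of_tendsto h1 (Eventually.of_forall fun s => ?_)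
  have h2 : ∑ x ∈ s, lp.single 2 x (h x) ∈ G.generator.map (LinearMap.fst ℝ (L2 V) (L2 V)) := by
    refine Submodule.sum_mem _ fun x _ => ?_
    obtain ⟨w, hw, -⟩ := exists_mem_generator_of_finite (G := G) (u := lp.single 2 x (h x))
      ((Set.finite_singleton x).subset fun y hy => by
        by_contra hne
        refine hy ?_
        rw [fn, lp.single_apply_ne (E := fun _ : V => ℝ) 2 x (h x) hne, zero_div])
    exact ⟨_, hw, rfl⟩
  obtain ⟨⟨u, w⟩, hw, e⟩ := h2
  exact ⟨w, by rw [← e]; exact hw⟩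

variable (G) in
/-- The gradient graph, scaled by `c`, as a subspace of a Hilbert space. -/
def gradGraph (c : ℝ) : Submodule ℝ (WithLp 2 (L2 V × L2 (V × V))) where
  carrier := {p | G.IsGrad p.fst (c • p.snd)}
  add_mem' := fun ha hb => by
    simpa using IsGrad.add ha hb
  zero_mem' := by simpa using isGrad_zero
  smul_mem' := fun r p hp => by
    change G.IsGrad (r • p.fst) (c • r • p.snd)
    rw [smul_comm]
    exact IsGrad.smul r hp

variable (G) in
theorem isClosed_gradGraph (c : ℝ) :
    IsClosed (G.gradGraph c : Set (WithLp 2 (L2 V × L2 (V × V)))) := by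
  refine IsSeqClosed.isClosed fun p p₀ hp hlim => ?_
  refine IsGrad.of_tendsto (l := atTop) (Eventually.of_forall hp) ?_ ?_
  · exact ((WithLp.fstL 2 ℝ (L2 V) (L2 (V × V))).continuous.tendsto _).comp hlim
  · exact (((WithLp.sndL 2 ℝ (L2 V) (L2 (V × V))).continuous.tendsto _).comp hlim).const_smul c

-- Riesz representation on the graph of the gradient scaled by 1/√α, whose inner product is ⟨u, v⟩ +
-- α⁻¹Q(u, v). Representing α⁻¹⟨g, ·⟩ there is the weak resolvent equation divided by α.
variable (G) in
theorem exists_resolvent {α : ℝ} (hα : 0 < α) (g : L2 V) :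
    ∃ u, (u, α • u - g) ∈ G.generator := by
  have hc := Real.sqrt_pos.2 hα
  have : CompleteSpace (G.gradGraph √α) := (G.isClosed_gradGraph √α).completeSpace_coe
  let F : StrongDual ℝ (G.gradGraph √α) :=
    (innerSL ℝ (α⁻¹ • g)).comp ((WithLp.fstL 2 ℝ (L2 V) (L2 (V × V))).comp
      (G.gradGraph √α).subtypeL)
  obtain ⟨u, hu⟩ : ∃ u, ∀ w, ⟪u, w⟫_ℝ = F w :=
    ⟨(InnerProductSpace.toDual ℝ _).symm F, fun w => InnerProductSpace.toDual_symm_apply⟩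
  refine ⟨u.1.fst, √α • u.1.snd, u.2, fun v b hb => ?_⟩
  have hw : WithLp.toLp 2 (v, (√α)⁻¹ • b) ∈ G.gradGraph √α := by
    change G.IsGrad v (√α • (√α)⁻¹ • b)
    rwa [smul_smul, mul_inv_cancel₀ hc.ne', one_smul]
  have h1 : ⟪u.1.fst, v⟫_ℝ + ⟪u.1.snd, (√α)⁻¹ • b⟫_ℝ = ⟪α⁻¹ • g, v⟫_ℝ := hu ⟨_, hw⟩
  simp only [inner_smul_right, inner_smul_left, RCLike.conj_to_real, inner_sub_left] at h1 ⊢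
  have h2 : α * (√α)⁻¹ = √α := by
    rw [← div_eq_mul_inv]; exact Real.div_sqrt
  have h3 : α * α⁻¹ = 1 := mul_inv_cancel₀ hα.ne'
  linear_combination α * h1 - ⟪u.1.snd, b⟫_ℝ * h2 + ⟪g, v⟫_ℝ * h3

variable (G) in
theorem isSelfAdjNonpos_generator : IsSelfAdjNonpos G.generator where
  symm := by
    rintro ⟨u, w⟩ ⟨a, ha, h⟩ ⟨u', w'⟩ ⟨a', ha', h'⟩
    rw [real_inner_comm _ u]
    simp only at *
    rw [h u' a' ha', h' u a ha, real_inner_comm]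
  nonpos := by
    rintro ⟨u, w⟩ ⟨a, ha, h⟩
    rw [h u a ha, Left.neg_nonpos_iff]
    exact real_inner_self_nonneg
  surj := fun α hα g => G.exists_resolvent hα g
  dense := G.dense_domain_generator

/-- The resolvent preserves nonnegative functions. -/
theorem nonneg_of_resolvent {α : ℝ} (hα : 0 < α) {u g : L2 V}
    (h : (u, α • u - g) ∈ G.generator) (hg : ∀ x, 0 ≤ g x) (x : V) : 0 ≤ u x := by
  obtain ⟨a, ha, h⟩ := h
  -- The test function is the negative part `v` of `u`. It satisfies Q(u, v) ≤ 0 and ⟨u, v⟩ = -‖v‖²,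
  -- so the resolvent equation with g ≥ 0 forces v = 0.
  set v : L2 V := L2.mk (fun x => max (-u x) 0) (Summable.of_nonneg_of_le (fun _ => sq_nonneg _)
    (fun x => by
      rw [sq_le_sq, abs_of_nonneg (le_max_right _ _)]
      exact max_le (neg_le_abs _) (abs_nonneg _)) (L2.summable_sq u)) with hv
  have hfn : ∀ x, G.fn v x = max (-G.fn u x) 0 := fun x => by
    simp only [fn, hv, L2.mk_apply]
    rw [← neg_div, ← max_div_div_right (G.sqrt_m_pos x).le, zero_div]
  have hcontr : ∀ x y, |G.fn v y - G.fn v x| ≤ |G.fn u y - G.fn u x| := fun x y => by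
    rw [hfn, hfn]
    refine (abs_max_sub_max_le_abs _ _ _).trans_eq ?_
    rw [← abs_neg]; congr 1; ring
  obtain ⟨b, hb⟩ : ∃ b, G.IsGrad v b := by
    refine exists_isGrad_of_summable (Summable.of_nonneg_of_le (G.energy_term_nonneg _)
      (fun p => ?_) (ha.hasSum_inner ha).summable)
    refine mul_le_mul_of_nonneg_left ?_ (div_nonneg (G.μ_nonneg _ _) two_pos.le)
    exact abs_le_iff_mul_self_le.1 (hcontr _ _)
  have h1 : ⟪a, b⟫_ℝ ≤ 0 := by
    refine hasSum_le (fun p => ?_) (ha.hasSum_inner hb) hasSum_zero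
    refine mul_nonpos_of_nonneg_of_nonpos (div_nonneg (G.μ_nonneg _ _) two_pos.le) ?_
    rw [hfn, hfn]
    rcases le_total (G.fn u p.1) (G.fn u p.2) with hle | hle
    · exact mul_nonpos_of_nonneg_of_nonpos (sub_nonneg.2 hle)
        (sub_nonpos.2 (max_le_max_right 0 (neg_le_neg hle)))
    · exact mul_nonpos_of_nonpos_of_nonneg (sub_nonpos.2 hle)
        (sub_nonneg.2 (max_le_max_right 0 (neg_le_neg hle)))
  have h2 : 0 ≤ ⟪g, v⟫_ℝ := hasSum_le (fun x => mul_nonneg (hg x) (le_max_right _ _))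
    hasSum_zero (L2.hasSum_inner g v)
  have h3 : ⟪u, v⟫_ℝ = -‖v‖ ^ 2 := by
    refine (L2.hasSum_inner u v).unique ((L2.hasSum_norm_sq v).neg.of_eq fun x => ?_)
    simp only [hv, L2.mk_apply]
    rcases le_total (-u x) 0 with h0 | h0
    · simp [max_eq_right h0]
    · rw [max_eq_left h0]; ring
  have h4 := h v b hb
  rw [inner_sub_left, inner_smul_left, RCLike.conj_to_real, h3] at h4
  have h5 : v = 0 := by
    rw [← norm_eq_zero, ← sq_eq_zero_iff]
    nlinarith [sq_nonneg ‖v‖]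
  have h6 : max (-u x) 0 = 0 := by
    have := congrArg (fun f : L2 V => f x) h5
    simpa [hv] using this
  have := (le_max_left (-u x) 0).trans_eq h6
  linarith

/-! ### The heat semigroup: positivity and agreement with its pointwise definition -/

section Heat

variable (G) in
/-- The heat semigroup in coordinates. -/
noncomputable def heatOp (t : ℝ) : L2 V →L[ℝ] L2 V := G.isSelfAdjNonpos_generator.P t

theorem J_nonneg {α : ℝ} (hα : 0 < α) {g : L2 V} (hg : ∀ x, 0 ≤ g x) (x : V) :
    0 ≤ G.isSelfAdjNonpos_generator.J α g x := by
  have h := nonneg_of_resolvent hα (G.isSelfAdjNonpos_generator.resolvent_mem hα g) hg x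
  rw [lp.coeFn_smul, Pi.smul_apply, smul_eq_mul] at h
  exact nonneg_of_mul_nonneg_right h (inv_pos.2 hα)

/-- Each Yosida exponential is a Poisson average of powers of J_α, and J_α preserves positivity. -/
theorem heatOp_nonneg {t : ℝ} (ht : 0 ≤ t) {g : L2 V} (hg : ∀ x, 0 ≤ g x) (x : V) :
    0 ≤ G.heatOp t g x := by
  refine ge_of_tendsto (((L2.continuous_apply x).tendsto _).comp
    (G.isSelfAdjNonpos_generator.tendsto_P ht g)) ?_
  filter_upwards [eventually_gt_atTop 0] with α hα
  have h := (hasSum_expOp_apply (G.isSelfAdjNonpos_generator.J α) α t g).mapL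
    (lp.evalCLM ℝ (fun _ : V => ℝ) 2 x)
  refine h.nonneg fun k => ?_
  have hk : ∀ k : ℕ, ∀ x, 0 ≤ (G.isSelfAdjNonpos_generator.J α ^ k) g x := by
    intro k
    induction k with
    | zero => simpa using hg
    | succ k ih =>
      intro x
      rw [pow_succ']
      exact J_nonneg hα ih x
  simp only [map_smul, smul_eq_mul]
  exact mul_nonneg (by positivity) (hk k x)

theorem Complete.resolvent_fn (hG : G.Complete) {α : ℝ} (hα : 0 < α) (g : L2 V) :
    α • G.resolvent α (G.fn g) = G.fn (G.isSelfAdjNonpos_generator.J α g) := by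
  set hL := G.isSelfAdjNonpos_generator
  have e : ∀ u : L2 V, α • G.fn u - G.fn g = G.fn (α • u - g) := fun u => by ext x; simp
  have hex : ∃ u, G.IsGenerator u (α • u - G.fn g) :=
    ⟨G.fn (α⁻¹ • hL.J α g), by
      rw [e, hG.isGenerator_fn_iff]; exact hL.resolvent_mem hα g⟩
  rw [resolvent, dif_pos hex]
  have h1 := hex.choose_spec
  obtain ⟨u, hu⟩ := G.mem_ell2_iff.1 h1.1.1
  rw [← hu, e, hG.isGenerator_fn_iff] at h1
  rw [← hu, hL.unique_of_mem hα h1 (hL.resolvent_mem hα g)]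
  ext x
  simp [hα.ne']

theorem Complete.yosidaExp_fn (hG : G.Complete) {α : ℝ} (hα : 0 < α) (t : ℝ) (g : L2 V) (x : V) :
    G.yosidaExp α t (G.fn g) x = G.fn (expOp (G.isSelfAdjNonpos_generator.A α) t g) x := by
  set hL := G.isSelfAdjNonpos_generator
  have hk : ∀ k : ℕ, (fun u => α • G.resolvent α u)^[k] (G.fn g) = G.fn ((hL.J α ^ k) g) := by
    intro k
    induction k with
    | zero => simp
    | succ k ih =>
      rw [Function.iterate_succ_apply', ih, hG.resolvent_fn hα, pow_succ']
      rfl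
  have h := ((hasSum_expOp_apply (hL.J α) α t g).mapL
    (lp.evalCLM ℝ (fun _ : V => ℝ) 2 x)).div_const √(G.m x)
  rw [yosidaExp, ← tsum_mul_left]
  refine HasSum.tsum_eq ?_
  refine HasSum.of_eq h fun k => ?_
  rw [hk]
  change Real.exp (-(t * α)) * ((t * α) ^ k / (k.factorial : ℝ) *
    ((hL.J α ^ k) g x / √(G.m x))) =
      Real.exp (-(t * α)) * ((t * α) ^ k / (k.factorial : ℝ)) * (hL.J α ^ k) g x / √(G.m x)
  ring

/-- The heat semigroup of the definition agrees with the semigroup of the generator. -/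
theorem Complete.heat_fn (hG : G.Complete) {t : ℝ} (ht : 0 ≤ t) (g : L2 V) :
    G.heat t (G.fn g) = G.fn (G.heatOp t g) := by
  ext x
  refine Tendsto.limUnder_eq ?_
  refine Tendsto.congr' ?_ (((G.continuous_fn x).tendsto _).comp
    (G.isSelfAdjNonpos_generator.tendsto_P ht g))
  filter_upwards [eventually_gt_atTop 0] with α hα
  exact (hG.yosidaExp_fn hα t g x).symm

theorem heat_zero (g : V → ℝ) : G.heat 0 g = g := by
  ext x
  have : ∀ α, G.yosidaExp α 0 g x = g x := fun α => by
    rw [yosidaExp, tsum_eq_single 0 fun k hk => by simp [hk]]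
    simp
  rw [heat]
  simp only [this]
  exact tendsto_const_nhds.limUnder_eq

end Heat

end WeightedGraph

/-! ### Finite energy from a lower Laplacian bound, and the weak Bochner inequality -/

namespace WeightedGraph

variable {V : Type*} {G : WeightedGraph V}

/-- Caccioppoli inequality: a nonnegative `ℓ²` function whose Laplacian is bounded below by an
`ℓ²` function has finite energy. -/
theorem Complete.exists_isGrad_of_le_lap (hG : G.Complete) {g q : L2 V} (hg : ∀ x, 0 ≤ G.fn g x)
    (hq : ∀ x, G.fn q x ≤ G.lap (G.fn g) x) : ∃ a, G.IsGrad g a := by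
  obtain ⟨η, h0, h1, hfin, hlim, hΓ⟩ := hG.exists_cutoff
  set f := G.fn g with hf
  have key : ∀ (s : Finset (V × V)) (k : ℕ),
      ∑ p ∈ s, G.μ p.1 p.2 / 2 * (η k p.2 * f p.2 - η k p.1 * f p.1) ^ 2
        ≤ (‖g‖ ^ 2 + ‖q‖ ^ 2) / 2 + ‖g‖ ^ 2 := by
    intro s k
    -- Test with η²f in Green's formula. As this is nonnegative, the lower bound on Δf together with
    -- Young's inequality bounds the resulting sum uniformly in `k`.
    have hφ : (Function.support fun x => η k x ^ 2 * f x).Finite :=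
      (hfin k).subset fun x hx h => hx (by simp [h])
    obtain ⟨S, hS1, hS2⟩ := G.green (u := f) (Or.inl hφ)
    have hS : -S ≤ (‖g‖ ^ 2 + ‖q‖ ^ 2) / 2 := by
      refine hasSum_le (fun x => ?_) hS1.neg
        (((G.hasSum_norm_sq_fn g).add (G.hasSum_norm_sq_fn q)).div_const 2)
      have e1 : 0 ≤ G.m x * (η k x ^ 2 * f x) :=
        mul_nonneg (G.m_pos x).le (mul_nonneg (sq_nonneg _) (hg x))
      have e2 := mul_le_mul_of_nonneg_left (hq x) e1
      have e3 : η k x ^ 2 ≤ 1 := pow_le_one₀ (h0 k x) (h1 k x)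
      have e4 : -(η k x ^ 2 * (f x * G.fn q x)) ≤ (f x ^ 2 + G.fn q x ^ 2) / 2 := by
        nlinarith [sq_nonneg (f x + G.fn q x), sq_nonneg (f x - G.fn q x), sq_nonneg (η k x)]
      have e5 := mul_le_mul_of_nonneg_left e4 (G.m_pos x).le
      calc -(G.m x * (η k x ^ 2 * f x) * G.lap f x)
          ≤ G.m x * -(η k x ^ 2 * (f x * G.fn q x)) := by linarith
        _ ≤ _ := e5
        _ = _ := by rw [← hf]; ring
    set F : V × V → ℝ := fun p => G.μ p.1 p.2 / 2 * (f p.1 ^ 2 * (η k p.2 - η k p.1) ^ 2) with hF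
    have hF0 : ∀ p, ¬ G.Adj p.1 p.2 → F p = 0 := fun p hp => by
      simp [hF, G.μ_eq_zero _ _ hp]
    have hFn : ∀ p, 0 ≤ F p := fun p =>
      mul_nonneg (div_nonneg (G.μ_nonneg _ _) two_pos.le) (by positivity)
    -- Only Γ(η_k) ≤ 1 is needed here: a uniform bound is enough, with no decay in `k`.
    have hFx : ∀ x, ∑ y ∈ (G.locallyFinite x).toFinset, F (x, y) ≤ G.m x * f x ^ 2 := by
      intro x
      calc _ = G.m x * G.Gam (η k) (η k) x * f x ^ 2 := by
            rw [m_mul_Gam, Finset.sum_mul]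
            refine Finset.sum_congr rfl fun y _ => ?_
            simp only [hF]; ring
        _ ≤ G.m x * 1 * f x ^ 2 := by
            have := (G.m_pos x).le
            gcongr
            refine (hΓ k x).trans ?_
            rw [div_le_one (by positivity)]
            linarith [(Nat.cast_nonneg k : (0 : ℝ) ≤ k)]
        _ = _ := by ring
    have hFs := (Summable.of_nonneg_of_le (fun x => Finset.sum_nonneg fun y _ => hFn (x, y)) hFx
      (G.hasSum_norm_sq_fn g).summable).hasSum
    have hT := hasSum_le hFx hFs (G.hasSum_norm_sq_fn g)
    have hE := G.hasSum_edge hF0 hFn hFs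
    have hsum := hS2.add ((hE.add (hasSum_swap hE)).div_const 2)
    -- The squared difference of ηf equals the product of the differences of f and η²f plus
    -- f(x)f(y)(η(y) - η(x))²; then 2f(x)f(y) ≤ f(x)² + f(y)².
    have hle : ∀ p : V × V, G.μ p.1 p.2 / 2 * (η k p.2 * f p.2 - η k p.1 * f p.1) ^ 2 ≤
        G.μ p.1 p.2 / 2 * ((f p.2 - f p.1) * (η k p.2 ^ 2 * f p.2 - η k p.1 ^ 2 * f p.1)) +
          (F p + F (p.2, p.1)) / 2 := by
      intro p
      have e : 0 ≤ G.μ p.1 p.2 / 2 * ((f p.1 - f p.2) ^ 2 * (η k p.2 - η k p.1) ^ 2) / 2 :=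
        div_nonneg (mul_nonneg (div_nonneg (G.μ_nonneg _ _) two_pos.le) (by positivity)) two_pos.le
      simp only [hF, G.μ_symm p.2 p.1]
      linarith
    refine (Finset.sum_le_sum fun p _ => hle p).trans ((sum_le_hasSum s (fun p _ => ?_) hsum).trans
      (by linarith))
    exact (mul_nonneg (div_nonneg (G.μ_nonneg _ _) two_pos.le) (sq_nonneg _)).trans (hle p)
  refine exists_isGrad_of_summable (summable_of_sum_le
    (c := (‖g‖ ^ 2 + ‖q‖ ^ 2) / 2 + ‖g‖ ^ 2) (G.energy_term_nonneg _) fun s => ?_)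
  refine le_of_tendsto' (x := atTop) (tendsto_finsetSum s fun p _ => ?_) (key s)
  have := ((((hlim p.2).mul_const (f p.2)).sub ((hlim p.1).mul_const (f p.1))).pow 2).const_mul
    (G.μ p.1 p.2 / 2)
  simpa [sq] using this

/-- A pointwise lower bound on the Laplacian holds in the weak sense. -/
theorem Complete.inner_le_of_le_lap (hG : G.Complete) {g q ψ : L2 V} {a b : L2 (V × V)}
    (ha : G.IsGrad g a) (hb : G.IsGrad ψ b) (hq : ∀ x, G.fn q x ≤ G.lap (G.fn g) x)
    (hψ : ∀ x, 0 ≤ G.fn ψ x) : ⟪ψ, q⟫_ℝ ≤ -⟪a, b⟫_ℝ := by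
  obtain ⟨φ, c, hfin, hc, hφ, hcb, hpos⟩ := hb.exists_approx hG
  refine le_of_tendsto_of_tendsto' (hφ.inner tendsto_const_nhds)
    (tendsto_const_nhds.inner hcb).neg fun k => ?_
  obtain ⟨S, h1, h2⟩ := G.green (u := G.fn g) (Or.inl (hfin k))
  rw [(ha.hasSum_inner (hc k)).unique h2, neg_neg]
  exact hasSum_le (fun x => mul_le_mul_of_nonneg_left (hq x)
    (mul_nonneg (G.m_pos x).le (hpos k x (hψ x)))) (G.hasSum_inner_fn (φ k) q) h1

/-- For functions of finite energy Γ(u, v) is summable, and nondegeneracy embeds ℓ¹ in ℓ². -/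
theorem Nondegenerate.exists_fn_eq_Gam (hN : G.Nondegenerate) {u v : L2 V} {a b : L2 (V × V)}
    (ha : G.IsGrad u a) (hb : G.IsGrad v b) : ∃ g, G.fn g = G.Gam (G.fn u) (G.fn v) := by
  refine hN.exists_fn_eq ?_
  have h := ha.hasSum_Gam hb (ψ := fun _ => 1) (S := ⟪a, b⟫_ℝ) (by
    simpa using L2.hasSum_inner a b)
  refine h.summable.abs.congr fun x => ?_
  rw [abs_mul, mul_one, abs_of_pos (G.m_pos x)]

theorem Nondegenerate.exists_fn_eq_sq (hN : G.Nondegenerate) (w : L2 V) :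
    ∃ k, G.fn k = fun x => G.fn w x ^ 2 := by
  refine hN.exists_fn_eq ((G.hasSum_norm_sq_fn w).summable.congr fun x => ?_)
  rw [abs_of_nonneg (sq_nonneg _)]

/-- Multiplication by the (bounded) values of an `ℓ²` function, transported along `r`. -/
theorem Nondegenerate.exists_mul (hN : G.Nondegenerate) {κ : Type*} (r : κ → V) :
    ∃ M : L2 V →L[ℝ] L2 κ →L[ℝ] L2 κ, ∀ ψ a k, M ψ a k = G.fn ψ (r k) * a k := by
  obtain ⟨δ, hδ, hm⟩ := hN
  have hc : ∀ x, |(√(G.m x))⁻¹| ≤ (√δ)⁻¹ := fun x => by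
    rw [abs_of_pos (inv_pos.2 (G.sqrt_m_pos x))]
    exact inv_anti₀ (Real.sqrt_pos.2 hδ) (Real.sqrt_le_sqrt (hm x))
  refine ⟨L2.mulLeft _ hc r, fun ψ a k => ?_⟩
  rw [L2.mulLeft_apply, fn, div_eq_inv_mul]

/-- Multiplication of gradients by an `ℓ²` function, evaluated at the initial vertices. -/
noncomputable def edgeMul (hN : G.Nondegenerate) : L2 V →L[ℝ] L2 (V × V) →L[ℝ] L2 (V × V) :=
  (hN.exists_mul Prod.fst).choose

/-- Pointwise multiplication of `ℓ²` functions by an `ℓ²` function. -/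
noncomputable def vertexMul (hN : G.Nondegenerate) : L2 V →L[ℝ] L2 V →L[ℝ] L2 V :=
  (hN.exists_mul id).choose

theorem hasSum_inner_edgeMul (hN : G.Nondegenerate) (ψ : L2 V) (a b : L2 (V × V)) :
    HasSum (fun p => G.fn ψ p.1 * a p * b p) ⟪edgeMul hN ψ a, b⟫_ℝ :=
  (L2.hasSum_inner _ _).of_eq fun p => by rw [edgeMul, (hN.exists_mul Prod.fst).choose_spec]

theorem inner_edgeMul_comm (hN : G.Nondegenerate) (ψ : L2 V) (a b : L2 (V × V)) :
    ⟪edgeMul hN ψ a, b⟫_ℝ = ⟪edgeMul hN ψ b, a⟫_ℝ :=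
  (hasSum_inner_edgeMul hN ψ a b).unique
    ((hasSum_inner_edgeMul hN ψ b a).of_eq fun p => by ring)

/-- Pairings with Γ become a trilinear form that is bounded in the ℓ² norms of ψ and of the
gradients, so continuity and the product rule apply along the heat flow. -/
theorem IsGrad.inner_Gam (hN : G.Nondegenerate) {u v g : L2 V} {a b : L2 (V × V)}
    (ha : G.IsGrad u a) (hb : G.IsGrad v b) (hg : G.fn g = G.Gam (G.fn u) (G.fn v)) (ψ : L2 V) :
    ⟪ψ, g⟫_ℝ = ⟪edgeMul hN ψ a, b⟫_ℝ := by
  refine (G.hasSum_inner_fn ψ g).unique ?_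
  rw [hg]
  exact ha.hasSum_Gam hb (hasSum_inner_edgeMul hN ψ a b)

theorem inner_sq (hN : G.Nondegenerate) {w k : L2 V} (hk : G.fn k = fun x => G.fn w x ^ 2)
    (ψ : L2 V) : ⟪ψ, k⟫_ℝ = ⟪vertexMul hN ψ w, w⟫_ℝ := by
  refine (G.hasSum_inner_fn ψ k).unique ((L2.hasSum_inner _ _).of_eq fun x => ?_)
  rw [vertexMul, (hN.exists_mul id).choose_spec, hk, id]
  have := G.m_mul_fn_mul_fn w w x
  linear_combination G.fn ψ x * this

theorem CD.le_lap_Gam {K n : ℝ} (hCD : G.CD K n) (f : V → ℝ) (x : V) :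
    2 * G.Gam f (G.lap f) x + 2 * K * G.Gam f f x + 2 / n * G.lap f x ^ 2 ≤
      G.lap (G.Gam f f) x := by
  have h := hCD f x
  rw [Gam2] at h
  have e : 2 / n * G.lap f x ^ 2 = 2 * (1 / n * G.lap f x ^ 2) := by ring
  linarith

/-- The curvature dimension inequality integrated against the heat flow of a test function. -/
theorem Complete.bochner (hG : G.Complete) (hN : G.Nondegenerate) {K n : ℝ} (hCD : G.CD K n)
    {u w ψ ψ' : L2 V} {a c : L2 (V × V)} (hu : (u, w) ∈ G.generator) (ha : G.IsGrad u a)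
    (hc : G.IsGrad w c) (hψ : (ψ, ψ') ∈ G.generator) (hpos : ∀ x, 0 ≤ G.fn ψ x) :
    2 * K * ⟪edgeMul hN ψ a, a⟫_ℝ + 2 / n * ⟪vertexMul hN ψ w, w⟫_ℝ ≤
      ⟪edgeMul hN ψ' a, a⟫_ℝ - 2 * ⟪edgeMul hN ψ a, c⟫_ℝ := by
  obtain ⟨g, hg⟩ := hN.exists_fn_eq_Gam ha ha
  obtain ⟨γ, hγ⟩ := hN.exists_fn_eq_Gam ha hc
  obtain ⟨k, hk⟩ := hN.exists_fn_eq_sq w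
  have hw := fn_eq_lap_of_mem_generator hu
  have hq : ∀ x, G.fn ((2 : ℝ) • γ + (2 * K) • g + (2 / n) • k) x ≤ G.lap (G.fn g) x := by
    intro x
    simp only [fn_add, fn_smul, hg, hγ, hk]
    simpa only [hw] using hCD.le_lap_Gam (G.fn u) x
  -- The decisive point: the curvature bound itself gives Γ(u) finite energy, which permits Γ(u) as
  -- a test function in the weak equation for ψ.
  obtain ⟨e, he⟩ := hG.exists_isGrad_of_le_lap (fun x => by rw [hg]; exact G.Gam_self_nonneg _ x) hq
  obtain ⟨b, hb, hgen⟩ := hψ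
  have h1 := hG.inner_le_of_le_lap he hb hq hpos
  rw [real_inner_comm b e, ← hgen g e he] at h1
  simp only [inner_add_right, inner_smul_right] at h1
  rw [ha.inner_Gam hN ha hg, ha.inner_Gam hN hc hγ, ha.inner_Gam hN ha hg, inner_sq hN hk] at h1
  linarith

end WeightedGraph

namespace WeightedGraph

variable {V : Type*} {G : WeightedGraph V}

/-! ### Gradients of the heat flow -/

section HeatGradient

variable (G) in
/-- The generator composed with the heat semigroup, in coordinates. -/
noncomputable def heatDeriv (t : ℝ) : L2 V →L[ℝ] L2 V := G.isSelfAdjNonpos_generator.D t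

open Classical in
variable (G) in
/-- The gradient in coordinates, with value `0` at functions of infinite energy. -/
noncomputable def grad (h : L2 V) : L2 (V × V) :=
  if H : ∃ a, G.IsGrad h a then H.choose else 0

theorem IsGrad.grad_eq {h : L2 V} {a : L2 (V × V)} (ha : G.IsGrad h a) : G.grad h = a := by
  have H : ∃ a, G.IsGrad h a := ⟨a, ha⟩
  rw [grad, dif_pos H]
  exact H.choose_spec.unique ha

theorem isGrad_grad {h : L2 V} (H : ∃ a, G.IsGrad h a) : G.IsGrad h (G.grad h) := by
  obtain ⟨a, ha⟩ := H
  rwa [ha.grad_eq]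

theorem isGrad_of_mem_generator {u w : L2 V} (h : (u, w) ∈ G.generator) :
    G.IsGrad u (G.grad u) := by
  obtain ⟨a, ha, -⟩ := h
  exact isGrad_grad ⟨a, ha⟩

theorem norm_grad_sq_of_mem_generator {u w : L2 V} (h : (u, w) ∈ G.generator) :
    ‖G.grad u‖ ^ 2 = -⟪w, u⟫_ℝ := by
  have ha := isGrad_of_mem_generator h
  rw [inner_eq_of_mem_generator h ha ha, neg_neg, real_inner_self_eq_norm_sq]

theorem heatOp_mem_generator {t : ℝ} (ht : 0 < t) (h : L2 V) :
    (G.heatOp t h, G.heatDeriv t h) ∈ G.generator :=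
  G.isSelfAdjNonpos_generator.D_mem ht h

theorem isGrad_heatOp {t : ℝ} (ht : 0 < t) (h : L2 V) :
    G.IsGrad (G.heatOp t h) (G.grad (G.heatOp t h)) :=
  isGrad_of_mem_generator (heatOp_mem_generator ht h)

/-- Each half of the time interval pays for one application of the generator. -/
theorem heatDeriv_mem_generator {t : ℝ} (ht : 0 < t) (h : L2 V) :
    ∃ z, (G.heatDeriv t h, z) ∈ G.generator := by
  refine ⟨G.heatDeriv (t / 2) (G.heatDeriv (t / 2) h), ?_⟩
  have := heatOp_mem_generator (G := G) (half_pos ht) (G.heatDeriv (t / 2) h)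
  have e : G.heatOp (t / 2) (G.heatDeriv (t / 2) h) = G.heatDeriv t h := by
    have := G.isSelfAdjNonpos_generator.D_add' (half_pos ht).le (half_pos ht) h
    rw [add_halves] at this
    exact this.symm
  rwa [e] at this

variable (G) in
/-- The gradient of the heat flow at a positive time is a bounded operator. -/
theorem exists_gradHeat {t : ℝ} (ht : 0 < t) :
    ∃ T : L2 V →L[ℝ] L2 (V × V), ∀ h, G.grad (G.heatOp t h) = T h := by
  let T : L2 V →ₗ[ℝ] L2 (V × V) :=
    { toFun := fun h => G.grad (G.heatOp t h)
      map_add' := fun h k => by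
        rw [map_add]
        exact ((isGrad_heatOp ht h).add (isGrad_heatOp ht k)).grad_eq
      map_smul' := fun c h => by
        rw [map_smul]
        exact ((isGrad_heatOp ht h).smul c).grad_eq }
  refine ⟨T.mkContinuous √(t⁻¹) fun h => ?_, fun h => rfl⟩
  refine L2.norm_le_of_sq_le (by positivity) ?_
  rw [mul_pow, Real.sq_sqrt (inv_nonneg.2 ht.le)]
  change ‖G.grad (G.heatOp t h)‖ ^ 2 ≤ _
  rw [norm_grad_sq_of_mem_generator (heatOp_mem_generator ht h), ← inner_neg_left]
  refine (real_inner_le_norm _ _).trans ?_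
  rw [norm_neg]
  calc ‖G.heatDeriv t h‖ * ‖G.heatOp t h‖ ≤ (t⁻¹ * ‖h‖) * ‖h‖ := by
        gcongr
        · exact G.isSelfAdjNonpos_generator.norm_D_le ht h
        · exact G.isSelfAdjNonpos_generator.norm_P_le ht.le h
    _ = _ := by ring

/-- Factor off the bounded operator ∇P_{t/2} and differentiate the remaining flow in ℓ². -/
theorem hasDerivAt_grad_heatOp {t : ℝ} (ht : 0 < t) (h : L2 V) :
    HasDerivAt (fun s => G.grad (G.heatOp s h)) (G.grad (G.heatDeriv t h)) t := by
  obtain ⟨T, hT⟩ := G.exists_gradHeat (half_pos ht)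
  have hL := G.isSelfAdjNonpos_generator
  have e : G.heatDeriv t h = G.heatOp (t / 2) (G.heatDeriv (t / 2) h) := by
    have := hL.D_add' (half_pos ht).le (half_pos ht) h
    rwa [add_halves] at this
  have h1 : HasDerivAt (fun s => G.heatOp (s - t / 2) h) (G.heatDeriv (t / 2) h) t := by
    have h2 : HasDerivAt (fun s => G.heatOp s h) (G.heatDeriv (t / 2) h) (t - t / 2) := by
      rw [sub_half]
      exact hL.hasDerivAt_P (half_pos ht) h
    simpa [Function.comp_def] using h2.scomp t ((hasDerivAt_id t).sub_const (t / 2))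
  rw [e, hT]
  refine (T.hasFDerivAt.comp_hasDerivAt t h1).congr_of_eventuallyEq ?_
  filter_upwards [eventually_gt_nhds (half_lt_self ht)] with s hs
  rw [Function.comp_apply, ← hT, heatOp, heatOp, heatOp,
    ← hL.P_add (half_pos ht).le (sub_pos.2 hs).le, add_sub_cancel]

theorem heatOp_pair_mem_generator {t : ℝ} (ht : 0 ≤ t) {u w : L2 V} (h : (u, w) ∈ G.generator) :
    (G.heatOp t u, G.heatOp t w) ∈ G.generator :=
  G.isSelfAdjNonpos_generator.P_mem ht h

theorem isGrad_heatOp_of_nonneg {t : ℝ} (ht : 0 ≤ t) {h : L2 V} {a : L2 (V × V)}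
    (ha : G.IsGrad h a) : G.IsGrad (G.heatOp t h) (G.grad (G.heatOp t h)) := by
  rcases ht.eq_or_lt with rfl | ht
  · rw [heatOp, G.isSelfAdjNonpos_generator.P_zero]
    exact isGrad_grad ⟨a, ha⟩
  · exact isGrad_heatOp ht h

/-- The heat flow decreases the energy. -/
theorem Complete.norm_grad_heatOp_le (hG : G.Complete) {t : ℝ} (ht : 0 ≤ t) {h : L2 V}
    {a : L2 (V × V)} (ha : G.IsGrad h a) : ‖G.grad (G.heatOp t h)‖ ≤ ‖a‖ := by
  have hL := G.isSelfAdjNonpos_generator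
  rcases ht.eq_or_lt with rfl | ht
  · rw [heatOp, hL.P_zero, ha.grad_eq]
  obtain ⟨g, b, hfin, hb, hg, hba, -⟩ := ha.exists_approx hG
  obtain ⟨T, hT⟩ := G.exists_gradHeat ht
  rw [hT]
  refine le_of_tendsto_of_tendsto' ((T.continuous.tendsto _).comp hg).norm hba.norm fun k => ?_
  obtain ⟨w, hw, -⟩ := exists_mem_generator_of_finite (hfin k)
  refine L2.norm_le_of_sq_le (norm_nonneg _) ?_
  rw [Function.comp_apply, ← hT, ← (hb k).grad_eq, norm_grad_sq_of_mem_generator hw,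
    norm_grad_sq_of_mem_generator (heatOp_pair_mem_generator ht.le hw)]
  exact hL.neg_inner_P_le ht.le hw

/-- The heat flow of a function of finite energy converges in energy at time zero. -/
theorem Complete.tendsto_grad_heatOp (hG : G.Complete) {h : L2 V} {a : L2 (V × V)}
    (ha : G.IsGrad h a) : Tendsto (fun t => G.grad (G.heatOp t h)) (𝓝[≥] 0) (𝓝 a) := by
  have hL := G.isSelfAdjNonpos_generator
  obtain ⟨g, b, hfin, hb, hg, hba, -⟩ := ha.exists_approx hG
  rw [Metric.tendsto_nhds]
  intro ε hε
  obtain ⟨k, hk⟩ := (Metric.tendsto_nhds.1 hba (ε / 3) (by positivity)).exists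
  obtain ⟨w, hw, -⟩ := exists_mem_generator_of_finite (hfin k)
  -- For an approximant in the domain, the energy of P_t g - g is -⟨P_t w - w, P_t g - g⟩, so strong
  -- continuity in ℓ² suffices. Energy contraction transfers the limit to `h`.
  have h1 : Tendsto (fun t => ‖G.grad (G.heatOp t (g k)) - b k‖ ^ 2) (𝓝[≥] 0) (𝓝 0) := by
    have h2 : Tendsto (fun t => -⟪G.heatOp t w - w, G.heatOp t (g k) - g k⟫_ℝ) (𝓝[≥] 0)
        (𝓝 (-⟪w - w, g k - g k⟫_ℝ)) :=
      (((hL.tendsto_P_zero w).sub_const w).inner ((hL.tendsto_P_zero (g k)).sub_const (g k))).neg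
    rw [sub_self, inner_zero_left, neg_zero] at h2
    refine h2.congr' ?_
    filter_upwards [self_mem_nhdsWithin] with t ht
    have h3 : (G.heatOp t (g k) - g k, G.heatOp t w - w) ∈ G.generator :=
      G.generator.sub_mem (heatOp_pair_mem_generator ht hw) hw
    rw [← norm_grad_sq_of_mem_generator h3,
      ((isGrad_heatOp_of_nonneg ht (hb k)).sub (hb k)).grad_eq]
  have h4 : Tendsto (fun t => ‖G.grad (G.heatOp t (g k)) - b k‖) (𝓝[≥] 0) (𝓝 0) := by
    simpa using h1.sqrt
  filter_upwards [self_mem_nhdsWithin, h4.eventually (gt_mem_nhds (by positivity : 0 < ε / 3))]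
    with t ht ht2
  have h5 := hG.norm_grad_heatOp_le ht (ha.sub (hb k))
  rw [map_sub, ((isGrad_heatOp_of_nonneg ht ha).sub (isGrad_heatOp_of_nonneg ht (hb k))).grad_eq] at h5
  rw [dist_eq_norm] at hk ⊢
  rw [norm_sub_rev] at hk
  calc ‖G.grad (G.heatOp t h) - a‖
      = ‖(G.grad (G.heatOp t h) - G.grad (G.heatOp t (g k))) +
          (G.grad (G.heatOp t (g k)) - b k) - (a - b k)‖ := by congr 1; abel
    _ ≤ ‖G.grad (G.heatOp t h) - G.grad (G.heatOp t (g k))‖ +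
          ‖G.grad (G.heatOp t (g k)) - b k‖ + ‖a - b k‖ :=
        (norm_sub_le _ _).trans (add_le_add_left (norm_add_le _ _) _)
    _ < ε := by linarith

end HeatGradient

/-! ### Interpolation along the heat flow: curvature implies the gradient estimate -/

section Estimate

theorem hasDerivAt_heatOp {t : ℝ} (ht : 0 < t) (h : L2 V) :
    HasDerivAt (fun s => G.heatOp s h) (G.heatDeriv t h) t :=
  G.isSelfAdjNonpos_generator.hasDerivAt_P ht h

theorem continuousAt_heatDeriv {t : ℝ} (ht : 0 < t) (h : L2 V) :
    ContinuousAt (fun s => G.heatDeriv s h) t := by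
  have hL := G.isSelfAdjNonpos_generator
  have h1 : ContinuousAt (fun s => G.heatDeriv (t / 2) (G.heatOp (s - t / 2) h)) t := by
    refine (G.heatDeriv (t / 2)).continuous.continuousAt.comp ?_
    have h2 : ContinuousAt (fun s => G.heatOp s h) (t - t / 2) :=
      (hasDerivAt_heatOp (by linarith) h).continuousAt
    exact ContinuousAt.comp (f := fun s => s - t / 2) h2 (by fun_prop)
  refine h1.congr ?_
  filter_upwards [eventually_gt_nhds (half_lt_self ht)] with s hs
  rw [heatDeriv, heatDeriv, heatOp, ← hL.D_add (half_pos ht) (sub_pos.2 hs).le, add_sub_cancel]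

theorem continuousOn_heatOp (h : L2 V) : ContinuousOn (fun s => G.heatOp s h) (Set.Ici 0) := by
  intro s hs
  rcases (Set.mem_Ici.1 hs).eq_or_lt with rfl | hs
  · have := G.isSelfAdjNonpos_generator.tendsto_P_zero h
    rw [← G.isSelfAdjNonpos_generator.P_zero h] at this
    simpa [ContinuousWithinAt, G.isSelfAdjNonpos_generator.P_zero, heatOp] using this
  · exact (hasDerivAt_heatOp hs h).continuousAt.continuousWithinAt

theorem Complete.continuousOn_grad_heatOp (hG : G.Complete) {h : L2 V} {a : L2 (V × V)}
    (ha : G.IsGrad h a) : ContinuousOn (fun s => G.grad (G.heatOp s h)) (Set.Ici 0) := by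
  intro s hs
  rcases (Set.mem_Ici.1 hs).eq_or_lt with rfl | hs
  · rw [ContinuousWithinAt, heatOp, G.isSelfAdjNonpos_generator.P_zero, ha.grad_eq]
    exact hG.tendsto_grad_heatOp ha
  · exact (hasDerivAt_grad_heatOp hs h).continuousAt.continuousWithinAt

variable (G) in
/-- The coordinates of the point evaluation at `x`. -/
theorem exists_evaluation (x : V) :
    ∃ e : L2 V, (∀ y, 0 ≤ e y) ∧ ∀ g, G.fn g x = ⟪e, g⟫_ℝ := by
  classical
  refine ⟨L2.mk (Pi.single x (√(G.m x))⁻¹) ?_, fun y => ?_, fun g => ?_⟩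
  · exact summable_of_hasFiniteSupport ((Set.finite_singleton x).subset fun y hy => by
      by_contra hne
      exact hy (by simp [Pi.single_eq_of_ne (show y ≠ x from hne)]))
  · rw [L2.mk_apply, Pi.single_apply]
    split_ifs
    · exact inv_nonneg.2 (Real.sqrt_nonneg _)
    · exact le_rfl
  · refine HasSum.unique ?_ (L2.hasSum_inner _ g)
    have := hasSum_single (f := fun y => (Pi.single x (√(G.m x))⁻¹ : V → ℝ) y * g y) x
      fun y hy => by simp [hy]
    simpa [fn, div_eq_inv_mul] using this

theorem heatOp_symm {t : ℝ} (ht : 0 ≤ t) (g h : L2 V) :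
    ⟪G.heatOp t g, h⟫_ℝ = ⟪g, G.heatOp t h⟫_ℝ :=
  G.isSelfAdjNonpos_generator.P_symm ht g h

/-- The curvature dimension condition implies the gradient estimate on the form domain. -/
theorem Complete.gradientEstimate (hG : G.Complete) (hN : G.Nondegenerate) {K n : ℝ} (hn : 0 < n)
    (hCD : G.CD K n) {h : L2 V} {a₀ : L2 (V × V)} (ha₀ : G.IsGrad h a₀) :
    G.GradientEstimate K n (G.fn h) := by
  intro t ht x
  obtain ⟨e, he, hev⟩ := G.exists_evaluation x
  have hheat : ∀ {s : ℝ}, 0 ≤ s → ∀ g, G.heat s (G.fn g) x = ⟪G.heatOp s e, g⟫_ℝ :=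
    fun hs g => by rw [hG.heat_fn hs, hev, heatOp_symm hs]
  set M := edgeMul hN with hM
  set N := vertexMul hN with hNd
  set ψ : ℝ → L2 V := fun s => G.heatOp s e with hψ
  set a : ℝ → L2 (V × V) := fun s => G.grad (G.heatOp (t - s) h) with ha
  set w : ℝ → L2 V := fun s => G.heatDeriv (t - s) h with hw
  set c : ℝ → L2 (V × V) := fun s => G.grad (G.heatDeriv (t - s) h) with hc
  have hψpos : ∀ s, 0 ≤ s → ∀ y, 0 ≤ G.fn (ψ s) y := fun s hs y =>
    div_nonneg (heatOp_nonneg hs he y) (Real.sqrt_nonneg _)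
  set I : ℝ → ℝ := fun s => Real.exp (-2 * K * s) * ⟪N (ψ s) (w s), w s⟫_ℝ with hI
  -- The endpoint s = t is excluded because `heatDeriv` takes the default value 0 at time 0; the
  -- integral does not see it.
  have hint : ∀ s ∈ Set.Ioo 0 t, G.integrand K t (G.fn h) x s = I s := by
    rintro s ⟨hs0, hst⟩
    have hts := sub_pos.2 hst
    obtain ⟨k, hk⟩ := hN.exists_fn_eq_sq (w s)
    rw [integrand, hG.heat_fn hts.le,
      ← fn_eq_lap_of_mem_generator (heatOp_mem_generator hts h), ← hk, hheat hs0.le,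
      inner_sq hN hk]
  have hIpos : ∀ s ∈ Set.Ioo 0 t, 0 ≤ I s := by
    rintro s ⟨hs0, hst⟩
    obtain ⟨k, hk⟩ := hN.exists_fn_eq_sq (w s)
    refine mul_nonneg (Real.exp_nonneg _) ?_
    rw [hNd, ← inner_sq hN hk]
    exact hasSum_le (fun y => mul_nonneg (mul_nonneg (G.m_pos y).le (hψpos s hs0.le y))
      (by rw [hk]; exact sq_nonneg _)) hasSum_zero (G.hasSum_inner_fn _ k)
  -- On [0, t] this is e^{-2Ks} P_s Γ(P_{t-s} f)(x), written so that no derivative of Γ is required.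
  set F : ℝ → ℝ := fun s => Real.exp (-2 * K * s) * ⟪M (ψ s) (a s), a s⟫_ℝ with hF
  set F' : ℝ → ℝ := fun s => Real.exp (-2 * K * s) *
    (⟪M (G.heatDeriv s e) (a s), a s⟫_ℝ - 2 * ⟪M (ψ s) (a s), c s⟫_ℝ -
      2 * K * ⟪M (ψ s) (a s), a s⟫_ℝ) with hF'
  have hexp : ∀ s, HasDerivAt (fun s => Real.exp (-2 * K * s))
      (Real.exp (-2 * K * s) * (-2 * K)) s := fun s => by
    simpa using ((hasDerivAt_id s).const_mul (-2 * K)).exp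
  have hFd : ∀ s ∈ Set.Ioo 0 t, HasDerivAt F (F' s) s := by
    rintro s ⟨hs0, hst⟩
    have hts := sub_pos.2 hst
    have d1 : HasDerivAt ψ (G.heatDeriv s e) s := hasDerivAt_heatOp hs0 e
    have d2 : HasDerivAt a (-c s) s := by
      have := (hasDerivAt_grad_heatOp (G := G) hts h).scomp s ((hasDerivAt_id s).const_sub t)
      simpa [Function.comp_def] using this
    have d3 : HasDerivAt (fun s => M (ψ s)) (M (G.heatDeriv s e)) s :=
      M.hasFDerivAt.comp_hasDerivAt s d1
    have d4 := (hexp s).mul ((d3.clm_apply d2).inner ℝ d2)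
    refine d4.congr_deriv ?_
    simp only [hF', map_neg, inner_add_left, inner_neg_left, inner_neg_right, hM,
      inner_edgeMul_comm hN (ψ s) (c s) (a s)]
    ring
  have hle : ∀ s ∈ Set.Ioo 0 t, 2 / n * I s ≤ F' s := by
    rintro s ⟨hs0, hst⟩
    have hts := sub_pos.2 hst
    obtain ⟨z, hz⟩ := heatDeriv_mem_generator hts h
    have := hG.bochner hN hCD (heatOp_mem_generator hts h) (isGrad_heatOp hts h)
      (isGrad_of_mem_generator hz) (heatOp_mem_generator hs0 e) (hψpos s hs0.le)
    simp only [hI, hF']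
    rw [mul_left_comm]
    refine mul_le_mul_of_nonneg_left ?_ (Real.exp_nonneg _)
    linarith
  have hFc : ContinuousOn F (Set.Icc 0 t) := by
    have c1 : ContinuousOn ψ (Set.Icc 0 t) := (continuousOn_heatOp e).mono fun s hs => hs.1
    have c2 : ContinuousOn a (Set.Icc 0 t) :=
      (hG.continuousOn_grad_heatOp ha₀).comp (f := fun s => t - s) (by fun_prop)
        fun s hs => sub_nonneg.2 hs.2
    have c3 : ContinuousOn (fun s => M (ψ s)) (Set.Icc 0 t) := M.continuous.comp_continuousOn c1
    exact (by fun_prop : Continuous fun s : ℝ => Real.exp (-2 * K * s)).continuousOn.mul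
      ((c3.clm_apply c2).inner c2)
  -- `F'` may be unbounded near the ends, but a nonnegative derivative of a function continuous on
  -- the closed interval is integrable. Domination by `F'` then gives convergence of the integral in
  -- the estimate.
  have hF'int : IntegrableOn F' (Set.Ioc 0 t) :=
    intervalIntegral.integrableOn_deriv_of_nonneg hFc hFd fun s hs =>
      (mul_nonneg (by positivity) (hIpos s hs)).trans (hle s hs)
  have hIc : ContinuousOn I (Set.Ioo 0 t) := by
    rintro s ⟨hs0, hst⟩
    have c1 : ContinuousAt ψ s := (hasDerivAt_heatOp hs0 e).continuousAt
    have c2 : ContinuousAt w s :=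
      ContinuousAt.comp (f := fun s => t - s) (continuousAt_heatDeriv (sub_pos.2 hst) h)
        (by fun_prop)
    have c3 : ContinuousAt (fun s => N (ψ s)) s := N.continuous.continuousAt.comp c1
    exact ((by fun_prop : Continuous fun s : ℝ => Real.exp (-2 * K * s)).continuousAt.mul
      ((c3.clm_apply c2).inner c2)).continuousWithinAt
  have hIint : IntegrableOn (fun s => 2 / n * I s) (Set.Ioo 0 t) := by
    refine Integrable.mono' (hF'int.mono_set Set.Ioo_subset_Ioc_self)
      ((continuousOn_const.mul hIc).aestronglyMeasurable measurableSet_Ioo) ?_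
    refine (ae_restrict_iff' measurableSet_Ioo).2 (Eventually.of_forall fun s hs => ?_)
    rw [Real.norm_of_nonneg (mul_nonneg (by positivity) (hIpos s hs))]
    exact hle s hs
  have hint' : IntegrableOn (fun s => 2 / n * G.integrand K t (G.fn h) x s) (Set.Ioo 0 t) :=
    hIint.congr_fun (fun s hs => by simp only [hint s hs]) measurableSet_Ioo
  have hii : IntervalIntegrable (fun s => 2 / n * G.integrand K t (G.fn h) x s) volume 0 t := by
    rw [intervalIntegrable_iff_integrableOn_Ioo_of_le ht]
    exact hint'
  have hfin : IntervalIntegrable (G.integrand K t (G.fn h) x) volume 0 t := by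
    have := hii.const_mul (n / 2)
    refine this.congr fun s _ => ?_
    field_simp
  refine ⟨hfin, ?_⟩
  have hmain := intervalIntegral.integral_le_sub_of_hasDeriv_right_of_le ht hFc
    (fun s hs => (hFd s hs).hasDerivWithinAt)
    (φ := fun s => 2 / n * G.integrand K t (G.fn h) x s)
    (by rw [integrableOn_Icc_iff_integrableOn_Ioo]; exact hint')
    (fun s hs => by rw [hint s hs]; exact hle s hs)
  rw [intervalIntegral.integral_const_mul] at hmain
  have hgrad : ∀ {s : ℝ}, 0 ≤ s → s ≤ t → ∀ g, G.fn g =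
      G.Gam (G.fn (G.heatOp (t - s) h)) (G.fn (G.heatOp (t - s) h)) →
      F s = Real.exp (-2 * K * s) * G.heat s (G.fn g) x := by
    intro s hs hst g hg
    have h1 := isGrad_heatOp_of_nonneg (sub_nonneg.2 hst) ha₀
    rw [hheat hs, h1.inner_Gam hN h1 hg]
  have h0 : F 0 = G.Gam (G.heat t (G.fn h)) (G.heat t (G.fn h)) x := by
    have h1 := isGrad_heatOp_of_nonneg (sub_nonneg.2 ht) ha₀
    obtain ⟨g, hg⟩ := hN.exists_fn_eq_Gam h1 h1
    rw [hgrad le_rfl ht g hg, heat_zero, hg, sub_zero, hG.heat_fn ht]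
    simp
  have h1 : F t = Real.exp (-2 * K * t) * G.heat t (G.Gam (G.fn h) (G.fn h)) x := by
    have e1 : G.heatOp (t - t) h = h := by
      rw [sub_self]; exact G.isSelfAdjNonpos_generator.P_zero h
    obtain ⟨g, hg⟩ := hN.exists_fn_eq_Gam ha₀ ha₀
    rw [hgrad ht le_rfl g (by rw [e1]; exact hg), hg]
  rw [h0, h1] at hmain
  linarith

end Estimate

end WeightedGraph

namespace WeightedGraph

variable {V : Type*} {G : WeightedGraph V}

/-! ### Locality of the curvature condition -/

section Locality

variable (G)

theorem lap_congr {f g : V → ℝ} {x : V} (hx : f x = g x) (h : ∀ y, G.Adj x y → f y = g y) :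
    G.lap f x = G.lap g x := by
  rw [lap, lap]
  congr 1
  refine Finset.sum_congr rfl fun y hy => ?_
  rw [hx, h y (by simpa using hy)]

theorem Gam_congr {f f' g g' : V → ℝ} {x : V} (hx : f x = f' x)
    (h : ∀ y, G.Adj x y → f y = f' y) (hx' : g x = g' x) (h' : ∀ y, G.Adj x y → g y = g' y) :
    G.Gam f g x = G.Gam f' g' x := by
  rw [Gam_eq, Gam_eq]
  congr 1
  refine Finset.sum_congr rfl fun y hy => ?_
  rw [hx, h y (by simpa using hy), hx', h' y (by simpa using hy)]

/-- The curvature dimension condition may be tested on finitely supported functions. -/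
theorem CD_of_finite {K n : ℝ} (h : ∀ f : V → ℝ, (Function.support f).Finite → ∀ x,
    (1 / n) * (G.lap f x) ^ 2 + K * G.Gam f f x ≤ G.Gam2 f f x) : G.CD K n := by
  classical
  intro f x
  -- Γ₂ at `x` involves Δf and Γ(f) at neighbours, hence `f` only on this finite set of vertices
  -- within two steps.
  set B : Set V := {x} ∪ ({y | G.Adj x y} ∪ ⋃ y ∈ {y | G.Adj x y}, {z | G.Adj y z}) with hB
  have hBfin : B.Finite := (Set.finite_singleton x).union ((G.locallyFinite x).union
    ((G.locallyFinite x).biUnion fun y _ => G.locallyFinite y))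
  set g : V → ℝ := B.indicator f with hg
  have hgf : ∀ y ∈ B, f y = g y := fun y hy => (Set.indicator_of_mem hy f).symm
  have hx : f x = g x := hgf x (Or.inl rfl)
  have h1 : ∀ y, G.Adj x y → f y = g y := fun y hy => hgf y (Or.inr (Or.inl hy))
  have h2 : ∀ y, G.Adj x y → ∀ z, G.Adj y z → f z = g z := fun y hy z hz =>
    hgf z (Or.inr (Or.inr (Set.mem_biUnion hy hz)))
  have hl : G.lap f x = G.lap g x := G.lap_congr hx h1
  have hl' : ∀ y, G.Adj x y → G.lap f y = G.lap g y := fun y hy =>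
    G.lap_congr (h1 y hy) (h2 y hy)
  have hΓ : G.Gam f f x = G.Gam g g x := G.Gam_congr hx h1 hx h1
  have hΓ' : ∀ y, G.Adj x y → G.Gam f f y = G.Gam g g y := fun y hy =>
    G.Gam_congr (h1 y hy) (h2 y hy) (h1 y hy) (h2 y hy)
  rw [Gam2, hl, hΓ, G.lap_congr hΓ hΓ', G.Gam_congr hx h1 hl hl']
  exact h g (hBfin.subset fun y hy => by_contra fun hne => hy (Set.indicator_of_notMem hne f)) x

theorem finite_support_Gam {f : V → ℝ} (hf : (Function.support f).Finite) :
    (Function.support (G.Gam f f)).Finite := by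
  have h1 : (Function.support fun y => f y * f y).Finite :=
    hf.subset fun y hy h => hy (by simp [h])
  refine ((G.finite_support_lap h1).union hf).subset fun x hx => ?_
  by_contra hne
  rw [Set.mem_union, not_or] at hne
  exact hx (by rw [Gam, Function.notMem_support.1 hne.1, Function.notMem_support.1 hne.2]; simp)

end Locality

/-! ### Differentiation at time zero: the gradient estimate implies curvature -/

section SmallTime

theorem heatOp_zero (h : L2 V) : G.heatOp 0 h = h := G.isSelfAdjNonpos_generator.P_zero h

/-- Membership in the domain of the squared generator makes the remainder quadratic in `t`. Finitely
supported functions qualify, as Δ preserves finite support. -/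
theorem hasDerivWithinAt_heatOp_zero {u w z : L2 V} (h : (u, w) ∈ G.generator)
    (h' : (w, z) ∈ G.generator) :
    HasDerivWithinAt (fun t => G.heatOp t u) w (Set.Ici 0) 0 := by
  rw [hasDerivWithinAt_iff_isLittleO]
  have h1 : (fun t => G.heatOp t u - G.heatOp 0 u - (t - 0) • w) =O[𝓝[≥] 0]
      fun t : ℝ => t ^ 2 := by
    refine Asymptotics.IsBigO.of_bound ‖z‖ ?_
    filter_upwards [self_mem_nhdsWithin] with t ht
    rw [mul_comm, norm_pow, Real.norm_eq_abs, sq_abs, heatOp_zero, sub_zero]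
    exact G.isSelfAdjNonpos_generator.norm_P_sub_sub_le ht h h'
  refine h1.trans_isLittleO ?_
  have : (fun s : ℝ => s ^ 2) =o[𝓝[≥] 0] fun s => s ^ 1 :=
    (Asymptotics.isLittleO_pow_pow (by norm_num : 1 < 2)).mono nhdsWithin_le_nhds
  simpa using this

theorem hasDerivWithinAt_fn_heatOp_zero {u w z : L2 V} (h : (u, w) ∈ G.generator)
    (h' : (w, z) ∈ G.generator) (x : V) :
    HasDerivWithinAt (fun t => G.fn (G.heatOp t u) x) (G.fn w x) (Set.Ici 0) 0 :=
  ((lp.evalCLM ℝ (fun _ : V => ℝ) 2 x).hasFDerivAt.comp_hasDerivWithinAt 0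
    (hasDerivWithinAt_heatOp_zero h h')).div_const √(G.m x)

theorem hasDerivWithinAt_Gam_heatOp_zero {u w z : L2 V} (h : (u, w) ∈ G.generator)
    (h' : (w, z) ∈ G.generator) (x : V) :
    HasDerivWithinAt (fun t => G.Gam (G.fn (G.heatOp t u)) (G.fn (G.heatOp t u)) x)
      (2 * G.Gam (G.fn u) (G.fn w) x) (Set.Ici 0) 0 := by
  have hd := hasDerivWithinAt_fn_heatOp_zero h h'
  simp only [Gam_eq]
  refine ((HasDerivWithinAt.fun_sum fun y _ => ((((hd y).sub (hd x)).mul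
    ((hd y).sub (hd x))).const_mul (G.μ x y / 2))).const_mul (G.m x)⁻¹).congr_deriv ?_
  simp only [mul_left_comm (2 : ℝ), Finset.mul_sum (a := (2 : ℝ))]
  congr 1
  refine Finset.sum_congr rfl fun y _ => ?_
  simp only [Pi.sub_apply, heatOp_zero]
  ring

/-- The gradient estimate for a finitely supported function at small times gives the curvature
dimension inequality for that function. -/
theorem GradientEstimate.curvature_le (hG : G.Complete) (hN : G.Nondegenerate) {K n : ℝ}
    (hn : 0 < n) {f : V → ℝ} (hf : (Function.support f).Finite) (h : G.GradientEstimate K n f)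
    (x : V) : (1 / n) * (G.lap f x) ^ 2 + K * G.Gam f f x ≤ G.Gam2 f f x := by
  obtain ⟨u, rfl⟩ := G.exists_fn_eq_of_finite hf
  obtain ⟨w, hw, hwl, hwf⟩ := exists_mem_generator_of_finite hf
  obtain ⟨z, hz, -⟩ := exists_mem_generator_of_finite hwf
  obtain ⟨g, hg⟩ := G.exists_fn_eq_of_finite (G.finite_support_Gam hf)
  obtain ⟨g', hg', hgl, hgf⟩ := exists_mem_generator_of_finite (G := G) (u := g)
    (by rw [hg]; exact G.finite_support_Gam hf)
  obtain ⟨g'', hg'', -⟩ := exists_mem_generator_of_finite hgf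
  obtain ⟨e, -, hev⟩ := G.exists_evaluation x
  set N := vertexMul hN with hNd
  -- Decoupling the times s and t - s turns the integrand into a function jointly continuous at the
  -- corner (0, 0), where it equals (Δf)²(x). For small `t` this bounds the integrand below by
  -- (Δf)²(x) - ε on all of [0, t].
  set I : ℝ × ℝ → ℝ := fun p => Real.exp (-2 * K * p.1) *
    ⟪N (G.heatOp p.1 e) (G.heatOp p.2 w), G.heatOp p.2 w⟫_ℝ with hI
  have hint : ∀ t s, 0 ≤ s → s ≤ t → G.integrand K t (G.fn u) x s = I (s, t - s) := by
    intro t s hs hst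
    have hts := sub_nonneg.2 hst
    obtain ⟨k, hk⟩ := hN.exists_fn_eq_sq (G.heatOp (t - s) w)
    rw [integrand, hG.heat_fn hts,
      ← fn_eq_lap_of_mem_generator (heatOp_pair_mem_generator hts hw), ← hk, hG.heat_fn hs, hev,
      ← heatOp_symm hs, inner_sq hN hk]
  have hI0 : I (0, 0) = G.lap (G.fn u) x ^ 2 := by
    obtain ⟨k, hk⟩ := hN.exists_fn_eq_sq w
    simp only [hI, mul_zero, Real.exp_zero, one_mul, heatOp_zero]
    rw [hNd, ← inner_sq hN hk, ← hev, hk, hwl]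
  have hIc : ContinuousWithinAt I (Set.Ici 0 ×ˢ Set.Ici 0) (0, 0) := by
    have c1 : ContinuousOn (fun p : ℝ × ℝ => G.heatOp p.1 e) (Set.Ici 0 ×ˢ Set.Ici 0) :=
      (continuousOn_heatOp e).comp continuous_fst.continuousOn fun p hp => hp.1
    have c2 : ContinuousOn (fun p : ℝ × ℝ => G.heatOp p.2 w) (Set.Ici 0 ×ˢ Set.Ici 0) :=
      (continuousOn_heatOp w).comp continuous_snd.continuousOn fun p hp => hp.2
    have c3 : ContinuousOn (fun p : ℝ × ℝ => N (G.heatOp p.1 e)) (Set.Ici 0 ×ˢ Set.Ici 0) :=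
      N.continuous.comp_continuousOn c1
    have c4 : ContinuousOn I (Set.Ici 0 ×ˢ Set.Ici 0) :=
      (by fun_prop : Continuous fun p : ℝ × ℝ => Real.exp (-2 * K * p.1)).continuousOn.mul
        ((c3.clm_apply c2).inner c2)
    exact c4 _ ⟨Set.mem_Ici.2 le_rfl, Set.mem_Ici.2 le_rfl⟩
  -- The gradient estimate bounds `A t` below by the integral term. Since A(0) = 0, dividing by `t`
  -- bounds the right derivative of `A` at 0, which is 2Γ₂(f) - 2KΓ(f) at `x`.
  set A : ℝ → ℝ := fun t => Real.exp (-2 * K * t) * G.fn (G.heatOp t g) x -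
    G.Gam (G.fn (G.heatOp t u)) (G.fn (G.heatOp t u)) x with hA
  have hA0 : A 0 = 0 := by
    simp [hA, heatOp_zero, hg]
  have hAd : HasDerivWithinAt A (-2 * K * G.Gam (G.fn u) (G.fn u) x +
      G.lap (G.Gam (G.fn u) (G.fn u)) x - 2 * G.Gam (G.fn u) (G.lap (G.fn u)) x)
      (Set.Ici 0) 0 := by
    have hexp : HasDerivAt (fun s => Real.exp (-2 * K * s)) (Real.exp (-2 * K * 0) * (-2 * K)) 0 :=
      by simpa using ((hasDerivAt_id (0 : ℝ)).const_mul (-2 * K)).exp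
    refine ((hexp.hasDerivWithinAt.mul (hasDerivWithinAt_fn_heatOp_zero hg' hg'' x)).sub
      (hasDerivWithinAt_Gam_heatOp_zero hw hz x)).congr_deriv ?_
    simp only [mul_zero, Real.exp_zero, heatOp_zero, hg, hgl, hwl]
    ring
  have hslope := (hasDerivWithinAt_iff_tendsto_slope' Set.self_notMem_Ioi).1
    (hAd.mono Set.Ioi_subset_Ici_self)
  have key : ∀ ε : ℝ, 0 < ε → 2 / n * (G.lap (G.fn u) x ^ 2 - ε) ≤
      -2 * K * G.Gam (G.fn u) (G.fn u) x +
      G.lap (G.Gam (G.fn u) (G.fn u)) x - 2 * G.Gam (G.fn u) (G.lap (G.fn u)) x := by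
    intro ε hε
    have h1 := hIc.eventually (lt_mem_nhds (sub_lt_self (I (0, 0)) hε))
    rw [hI0, nhdsWithin_prod_eq] at h1
    obtain ⟨s, hs, h2⟩ := mem_prod_self_iff.1 h1
    obtain ⟨δ, hδ, hδs⟩ := mem_nhdsGE_iff_exists_Ico_subset.1 hs
    refine ge_of_tendsto hslope ?_
    filter_upwards [Ioo_mem_nhdsGT hδ] with t ht
    obtain ⟨hi, hle⟩ := h t ht.1.le x
    rw [hG.heat_fn ht.1.le, ← hg, hG.heat_fn ht.1.le] at hle
    have h3 : ∫ _ in (0 : ℝ)..t, (G.lap (G.fn u) x ^ 2 - ε) ≤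
        ∫ s in (0 : ℝ)..t, G.integrand K t (G.fn u) x s := by
      refine intervalIntegral.integral_mono_on ht.1.le intervalIntegrable_const hi fun r hr => ?_
      rw [hint t r hr.1 hr.2]
      have h4 : (r, t - r) ∈ s ×ˢ s := ⟨hδs ⟨hr.1, hr.2.trans_lt ht.2⟩,
        hδs ⟨sub_nonneg.2 hr.2, (sub_le_self t hr.1).trans_lt ht.2⟩⟩
      exact le_of_lt (h2 h4)
    rw [intervalIntegral.integral_const, sub_zero, smul_eq_mul] at h3
    rw [slope_def_field, hA0, sub_zero, sub_zero, le_div_iff₀ ht.1]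
    have h4 := mul_le_mul_of_nonneg_left h3 (by positivity : 0 ≤ 2 / n)
    simp only [hA]
    linarith
  rw [Gam2]
  have h5 : 2 / n * G.lap (G.fn u) x ^ 2 ≤ -2 * K * G.Gam (G.fn u) (G.fn u) x +
      G.lap (G.Gam (G.fn u) (G.fn u)) x - 2 * G.Gam (G.fn u) (G.lap (G.fn u)) x := by
    refine le_of_forall_pos_le_add fun ε hε => ?_
    have := key (n / 2 * ε) (by positivity)
    have e2 : 2 / n * (n / 2 * ε) = ε := by field_simp
    rw [mul_sub, e2] at this
    linarith
  have e3 : 2 / n * G.lap (G.fn u) x ^ 2 = 2 * (1 / n * G.lap (G.fn u) x ^ 2) := by ring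
  linarith

end SmallTime

end WeightedGraph

theorem theorem3p3 {V : Type*} (G : WeightedGraph V) (hcomplete : G.Complete)
    (hnondeg : G.Nondegenerate) (K n : ℝ) (hn : 0 < n) :
    List.TFAE [
      G.CD K n,
      ∀ f : V → ℝ, (Function.support f).Finite → G.GradientEstimate K n f,
      ∀ f ∈ G.domQ, G.GradientEstimate K n f] := by
  tfae_have 1 → 3 := by
    intro hCD f hf
    obtain ⟨h, a, ha, rfl⟩ := hcomplete.mem_domQ_iff.1 hf
    exact hcomplete.gradientEstimate hnondeg hn hCD ha
  tfae_have 3 → 2 := by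
    intro H f hf
    obtain ⟨h, rfl⟩ := G.exists_fn_eq_of_finite hf
    obtain ⟨a, ha⟩ := WeightedGraph.exists_isGrad_of_finite hf
    exact H _ (hcomplete.mem_domQ_iff.2 ⟨h, a, ha, rfl⟩)
  tfae_have 2 → 1 := fun H => G.CD_of_finite fun f hf x =>
    (H f hf).curvature_le hcomplete hnondeg hn hf x
  tfae_finish
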